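/- Let $B_k$ denote the Bernoulli numbers ($\sum_k B_k x^k/k! = x/(e^x-1)$). For integers $r$ and $s,t\ge 0$ put $$S_{r,s,t}:=\sum_{s\le i_1<\dots<i_r\le t}\frac1{i_1\cdots i_r},$$ with $S_{0,s,t}=1$ if $t\ge s-1$, and $S_{r,s,t}=0$ if $r<0$ or $t<r+s-1$. Let $p\ge 1$ and $q\ge 0$ be integers, and define $$c_{p,q,k,r}:=\frac{B_{2k}}{(2k)!}\,\frac{q!}{(q-2k+1)!}\,\frac{p!}{(p-r)!}\,S_{r,q-2k+2,q}\qquad(2k\le q+1,\ 0\le r\le p),$$ $$d_{p,q,k,r}:=\frac{B_{2k}(-1)^{r+q+1}}{(2k)(2k-1)\cdots(2k-q-1)}\,\frac{p!\,q!}{(p-r)!}\sum_{j=0}^q(-1)^jS_{j,1,q}\,S_{r-j-1,1,2k-q-2}\qquad(2k\ge q+2,\ 1\le r\le p).$$ Then the number $$\mathrm{const}:=(-1)^p\zeta^{(p)}(-q)+\frac{B_{q+1}}{q+1}\,p!\,S_{p,1,q}$$ is real, and the following hold. (a) For every integer $m\ge 0$, as $n\to\infty$, $$\sum_{k=1}^n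 k^q(\log k)^p = n^{q+1}\sum_{r=0}^p\frac{(-1)^rp!}{(p-r)!}\frac{(\log n)^{p-r}}{(q+1)^{r+1}}+\tfrac12 n^q(\log n)^p+\sum_{k=1}^{\lceil q/2\rceil}\Big(\sum_{r=0}^p c_{p,q,k,r}(\log n)^{p-r}\Big)n^{q-2k+1}$$ $$\qquad+\,\mathrm{const}+\sum_{k=\lceil q/2\rceil+1}^m\frac{\sum_{r=1}^p d_{p,q,k,r}(\log n)^{p-r}}{n^{2k-q-1}}+O\Big(\frac{(\log n)^{p-1}}{n^{2m-q}}\Big),$$ where, for odd $q$, the term with $k=\lceil q/2\rceil$, $r=p$ of the sum with the $c_{p,q,k,r}$ (it is independent of $n$ and equals $\frac{B_{q+1}}{q+1}p!\,S_{p,1,q}$) is left out, being already contained in $\mathrm{const}$; the sum with the $d_{p,q,k,r}$ is empty if $m\le\lceil q/2\rceil$. The implied constant depends on $p,q,m$ only. (b) $\mathrm{const}$ is given by the formal (divergent) Euler–Maclaurin series $$\frac{(-1)^{p+1}p!}{(q+1)^{p+1}}-\sum_{k=1}^{\lfloor q/2\rfloor}c_{p,q,k,p}-\sum_{k\ge\lceil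 q/2\rceil+1}d_{p,q,k,p}$$ in the following sense: for every integer $M\ge\lceil q/2\rceil+1$, with $f(x)=x^q(\log x)^p$, $B_{2M}(\cdot)$ the Bernoulli polynomial and $\{x\}$ the fractional part of $x$, the integral below converges absolutely and $$\mathrm{const}=\frac{(-1)^{p+1}p!}{(q+1)^{p+1}}-\sum_{k=1}^{\lfloor q/2\rfloor}c_{p,q,k,p}-\sum_{k=\lceil q/2\rceil+1}^{M}d_{p,q,k,p}-\int_1^\infty\frac{B_{2M}(\{x\})}{(2M)!}f^{(2M)}(x)\,dx .$$ -/

import Mathlib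

open Filter Asymptotics MeasureTheory

noncomputable section

namespace LogPowerSum

/-- `S_{r,s,t}`: the sum of `1 / (i₁ ⋯ i_r)` over integers `s ≤ i₁ < ⋯ < i_r ≤ t`, with
`S_{0,s,t} = 1` if `t ≥ s - 1`, and `S_{r,s,t} = 0` if `r < 0` or `t < r + s - 1`. -/
def S (r : ℤ) (s t : ℕ) : ℝ :=
  if r < 0 ∨ t + 1 < s then 0
  else ∑ A ∈ (Finset.Icc s t).powersetCard r.toNat, ∏ i ∈ A, (1 / (i : ℝ))

/-- `c_{p,q,k,r} = B_{2k}/(2k)! · q!/(q-2k+1)! · p!/(p-r)! · S_{r,q-2k+2,q}`,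
used only for `2k ≤ q + 1` and `r ≤ p`. -/
def c (p q k r : ℕ) : ℝ :=
  (bernoulli (2 * k) : ℝ) / ((2 * k).factorial : ℝ)
    * ((q.factorial : ℝ) / ((q + 1 - 2 * k).factorial : ℝ))
    * ((p.factorial : ℝ) / ((p - r).factorial : ℝ))
    * S r (q + 2 - 2 * k) q

/-- `d_{p,q,k,r} = B_{2k} (-1)^{r+q+1} / ((2k)(2k-1)⋯(2k-q-1)) · p! q!/(p-r)!
  · ∑_{j=0}^q (-1)^j S_{j,1,q} S_{r-j-1,1,2k-q-2}`,
used only for `2k ≥ q + 2` and `r ≤ p`. -/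
def d (p q k r : ℕ) : ℝ :=
  (bernoulli (2 * k) : ℝ) * (-1) ^ (r + q + 1)
      / (∏ i ∈ Finset.range (q + 2), (2 * (k : ℝ) - (i : ℝ)))
    * ((p.factorial : ℝ) * (q.factorial : ℝ) / ((p - r).factorial : ℝ))
    * ∑ j ∈ Finset.range (q + 1), (-1) ^ j * S j 1 q * S ((r : ℤ) - j - 1) 1 (2 * k - q - 2)

/-- The explicit part of the expansion, without the constant term, up to order `m`.
In natural numbers `(q + 1) / 2 = ⌈q/2⌉`. In the first double sum the term that is constant
in `n` (`q` odd, `k = (q+1)/2`, `r = p`) is left out. -/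
def expansion (p q m n : ℕ) : ℝ :=
  (n : ℝ) ^ (q + 1) * ∑ r ∈ Finset.range (p + 1),
      (-1) ^ r * (p.factorial : ℝ) / ((p - r).factorial : ℝ)
        * (Real.log n ^ (p - r) / ((q : ℝ) + 1) ^ (r + 1))
    + 1 / 2 * (n : ℝ) ^ q * Real.log n ^ p
    + ∑ k ∈ Finset.Icc 1 ((q + 1) / 2),
        (∑ r ∈ Finset.range (p + 1),
          if 2 * k = q + 1 ∧ r = p then 0 else c p q k r * Real.log n ^ (p - r))
          * (n : ℝ) ^ (q + 1 - 2 * k)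
    + ∑ k ∈ Finset.Icc ((q + 1) / 2 + 1) m,
        (∑ r ∈ Finset.Icc 1 p, d p q k r * Real.log n ^ (p - r)) / (n : ℝ) ^ (2 * k - q - 1)

/-- The Euler–Maclaurin remainder integrand of order `2M` for `f(x) = x^q (log x)^p`:
`B_{2M}({x}) / (2M)! · f^{(2M)}(x)`. -/
def remainderIntegrand (p q M : ℕ) (x : ℝ) : ℝ :=
  bernoulliFun (2 * M) (Int.fract x) / ((2 * M).factorial : ℝ)
    * iteratedDeriv (2 * M) (fun y : ℝ => y ^ q * Real.log y ^ p) x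

end LogPowerSum

end

/-! The expansion is Euler–Maclaurin for `f(x) = x^q (log x)^p`; the constant comes from
Euler–Maclaurin for the complex powers `x^w`, differentiated `p` times in `w` at `w = q`.

Since `f` is the `p`-th `ε`-derivative of `x^(q+ε)` at `0`, its `j`-th derivative is `x^(q-j) ∑_r
p!/(p-r)! a_r (log x)^(p-r)`, where `a_r` is the coefficient of `ε^r` in `∏_{i<j} (q - i + ε)`.
Pulling the nonzero constants out of the factors turns these coefficients into elementary symmetric
functions of reciprocals. For `j ≤ q` this gives the `c` (`c_eq`). For `j > q` the factor `i = q` is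
`ε` itself, so the term `r = 0` vanishes, which is why only `(log n)^(p-1)` survives, and the Cauchy
product of the factors before and after it gives the `d` (`d_eq`). The remainder integral converges
once `2M ≥ q + 2`, which yields the expansion with the constant `constantOfOrder`
(`sum_pow_mul_log_pow_eq`).

For the closed form, `zetaApprox M n w` is `∑_{k≤n} k^w` minus its boundary terms at `n`. Its
increments are remainder integrals over unit intervals, so it converges locally uniformly for `re w
< 2M - 1`, `w ≠ -1`. For `re w < -1` the boundary terms vanish in the limit, which is `ζ(-w)`; the
identity theorem extends this to a neighbourhood of `q`. Locally uniform limits of holomorphic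
functions commute with derivatives, so the `p`-th derivative at `q` tends to `(-1)^p ζ^(p)(-q)`, and
it also tends to the constant minus the `n`-independent boundary term (`constantOfOrder_eq`). -/

namespace LogPowerSum

/-! ### The Euler–Maclaurin formula -/

/-- The Bernoulli polynomial divided by the factorial of its degree. -/
noncomputable def bernoulliDiv (N : ℕ) (t : ℝ) : ℝ := bernoulliFun N t / (N.factorial : ℝ)

theorem continuous_bernoulliDiv (N : ℕ) : Continuous (bernoulliDiv N) :=
  (continuous_bernoulliFun N).div_const _

theorem hasDerivAt_bernoulliDiv (N : ℕ) (t : ℝ) :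
    HasDerivAt (bernoulliDiv (N + 1)) (bernoulliDiv N t) t := by
  have h := (hasDerivAt_bernoulliFun (N + 1) t).div_const ((N + 1).factorial : ℝ)
  refine h.congr_deriv ?_
  have h1 : (N.factorial : ℝ) ≠ 0 := by positivity
  have h2 : (N : ℝ) + 1 ≠ 0 := by positivity
  simp only [bernoulliDiv, Nat.factorial_succ, Nat.add_sub_cancel]
  push_cast
  field_simp

theorem bernoulliDiv_zero_right (N : ℕ) :
    bernoulliDiv N 0 = (bernoulli N : ℝ) / (N.factorial : ℝ) := by
  rw [bernoulliDiv, bernoulliFun_eval_zero]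

theorem bernoulliDiv_one_right {N : ℕ} (hN : N ≠ 1) :
    bernoulliDiv N 1 = (bernoulli N : ℝ) / (N.factorial : ℝ) := by
  rw [bernoulliDiv, bernoulliFun_endpoints_eq_of_ne_one hN, bernoulliFun_eval_zero]

theorem exists_abs_bernoulliDiv_le (N : ℕ) :
    ∃ C : ℝ, 0 < C ∧ ∀ t ∈ Set.Icc (0 : ℝ) 1, |bernoulliDiv N t| ≤ C := by
  obtain ⟨C, hC⟩ := isCompact_Icc.exists_bound_of_continuousOn
    (continuous_bernoulliDiv N).continuousOn (s := Set.Icc (0 : ℝ) 1)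
  exact ⟨max C 1, by positivity, fun t ht => (hC t ht).trans (le_max_left _ _)⟩

section

variable {E : Type*} [NormedAddCommGroup E] [NormedSpace ℝ E]

/-- The boundary terms of the Euler–Maclaurin formula for `G 1`, where `G 0` is a primitive
and `G (j + 1)` the `j`-th derivative. -/
noncomputable def eulerMaclaurinMain (G : ℕ → ℝ → E) (M : ℕ) (x : ℝ) : E :=
  G 0 x + (1 / 2 : ℝ) • G 1 x
    + ∑ k ∈ Finset.Icc 1 M, ((bernoulli (2 * k) : ℝ) / ((2 * k).factorial : ℝ)) • G (2 * k) x

theorem integral_bernoulliDiv_fract (g : ℝ → E) (N k : ℕ) :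
    ∫ x in (k : ℝ)..k + 1, bernoulliDiv N (Int.fract x) • g x
      = ∫ x in (k : ℝ)..k + 1, bernoulliDiv N (x - k) • g x := by
  rw [intervalIntegral.integral_of_le (by linarith), intervalIntegral.integral_of_le (by linarith),
    -- At `k + 1` the fractional part jumps back to `0`; this null endpoint has to be removed.
    integral_Ioc_eq_integral_Ioo, integral_Ioc_eq_integral_Ioo]
  refine setIntegral_congr_fun measurableSet_Ioo fun x hx => ?_
  have : Int.fract x = x - k := by
    rw [Int.fract_eq_iff]
    exact ⟨by linarith [hx.1], by linarith [hx.2], k, by simp⟩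
  simp only [this]

variable [CompleteSpace E]

/-- One integration by parts. Values in a general `E` allow use for both the real family
`logPowDeriv` and the complex family `cpowDeriv`. -/
theorem integral_bernoulliDiv_smul_succ (G : ℕ → ℝ → E) (a : ℝ)
    (hG : ∀ j, ∀ x ∈ Set.Icc a (a + 1), HasDerivAt (G j) (G (j + 1) x) x) (N : ℕ) :
    ∫ x in a..a + 1, bernoulliDiv (N + 1) (x - a) • G (N + 2) x
      = bernoulliDiv (N + 1) 1 • G (N + 1) (a + 1) - bernoulliDiv (N + 1) 0 • G (N + 1) a
        - ∫ x in a..a + 1, bernoulliDiv N (x - a) • G (N + 1) x := by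
  have hle : a ≤ a + 1 := by linarith
  have hcont (j : ℕ) : ContinuousOn (G j) (Set.uIcc a (a + 1)) := by
    rw [Set.uIcc_of_le hle]
    exact fun x hx => (hG j x hx).continuousAt.continuousWithinAt
  have hint (n j : ℕ) :
      IntervalIntegrable (fun x => bernoulliDiv n (x - a) • G j x) volume a (a + 1) :=
    ((((continuous_bernoulliDiv n).comp (continuous_id.sub continuous_const)).continuousOn).smul
      (hcont j)).intervalIntegrable
  have hFTC := intervalIntegral.integral_eq_sub_of_hasDerivAt (a := a) (b := a + 1)
    (f := fun x => bernoulliDiv (N + 1) (x - a) • G (N + 1) x)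
    (f' := fun x => bernoulliDiv (N + 1) (x - a) • G (N + 2) x
      + bernoulliDiv N (x - a) • G (N + 1) x)
    (fun x hx => by
      rw [Set.uIcc_of_le hle] at hx
      exact (((hasDerivAt_bernoulliDiv N (x - a)).comp_sub_const x a)).smul (hG (N + 1) x hx))
    ((hint _ _).add (hint _ _))
  rw [intervalIntegral.integral_add (hint _ _) (hint _ _)] at hFTC
  rw [eq_sub_iff_add_eq, hFTC]
  simp

/-- Each increase of `M` costs two integrations by parts; the odd one leaves no boundary term
because odd Bernoulli numbers beyond `B_1` vanish. In the base case the values `±1/2` of `B_1(t)` at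
the endpoints give the trapezoidal term. -/
theorem eulerMaclaurin_unit (G : ℕ → ℝ → E) (a : ℝ)
    (hG : ∀ j, ∀ x ∈ Set.Icc a (a + 1), HasDerivAt (G j) (G (j + 1) x) x) (M : ℕ) (hM : 1 ≤ M) :
    G 1 (a + 1) = eulerMaclaurinMain G M (a + 1) - eulerMaclaurinMain G M a
      - ∫ x in a..a + 1, bernoulliDiv (2 * M) (x - a) • G (2 * M + 1) x := by
  have hstep := integral_bernoulliDiv_smul_succ G a hG
  induction M, hM using Nat.le_induction with
  | base =>
    have h0 : ∫ x in a..a + 1, bernoulliDiv 0 (x - a) • G 1 x = G 0 (a + 1) - G 0 a := by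
      have hle : a ≤ a + 1 := by linarith
      simp only [bernoulliDiv, bernoulliFun_zero, Nat.factorial_zero, Nat.cast_one, div_one,
        one_smul]
      refine intervalIntegral.integral_eq_sub_of_hasDerivAt (fun x hx => ?_) ?_
      · rw [Set.uIcc_of_le hle] at hx
        exact hG 0 x hx
      · refine ContinuousOn.intervalIntegrable fun x hx => ?_
        rw [Set.uIcc_of_le hle] at hx
        exact (hG 1 x hx).continuousAt.continuousWithinAt
    have h1 := hstep 0
    have h2 := hstep 1
    simp only [zero_add, Nat.reduceAdd] at h1 h2
    rw [bernoulliDiv_one_right (by norm_num), bernoulliDiv_zero_right, h1, h0] at h2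
    rw [mul_one, h2]
    have e1 : bernoulliDiv 1 1 = 1 / 2 := by norm_num [bernoulliDiv]
    have e2 : bernoulliDiv 1 0 = -(1 / 2) := by norm_num [bernoulliDiv]
    rw [e1, e2]
    simp only [eulerMaclaurinMain, Finset.Icc_self, Finset.sum_singleton, mul_one]
    module
  | succ M hM ih =>
    have h1 := hstep (2 * M)
    have h2 := hstep (2 * M + 1)
    have hodd : bernoulli (2 * M + 1) = 0 := bernoulli_eq_zero_of_odd ⟨M, rfl⟩ (by omega)
    rw [bernoulliDiv_one_right (by omega), bernoulliDiv_zero_right, hodd] at h1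
    rw [bernoulliDiv_one_right (by omega), bernoulliDiv_zero_right, h1] at h2
    have hmain (x : ℝ) : eulerMaclaurinMain G (M + 1) x = eulerMaclaurinMain G M x
        + ((bernoulli (2 * (M + 1)) : ℝ) / ((2 * (M + 1)).factorial : ℝ)) • G (2 * (M + 1)) x := by
      simp only [eulerMaclaurinMain]
      rw [Finset.sum_Icc_succ_top (by omega)]
      module
    rw [hmain, hmain, show 2 * (M + 1) = 2 * M + 1 + 1 by ring, h2]
    simp only [Rat.cast_zero, zero_div, zero_smul]
    conv_lhs => rw [ih]
    module

theorem eulerMaclaurin_step (G : ℕ → ℝ → E)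
    (hG : ∀ j, ∀ x : ℝ, 0 < x → HasDerivAt (G j) (G (j + 1) x) x) (M : ℕ) (hM : 1 ≤ M)
    (k : ℕ) (hk : 1 ≤ k) :
    G 1 (k + 1 : ℕ) = eulerMaclaurinMain G M (k + 1 : ℕ) - eulerMaclaurinMain G M k
      - ∫ x in (k : ℝ)..(k + 1 : ℕ), bernoulliDiv (2 * M) (Int.fract x) • G (2 * M + 1) x := by
  have hk' : (1 : ℝ) ≤ k := by exact_mod_cast hk
  push_cast
  rw [integral_bernoulliDiv_fract]
  exact eulerMaclaurin_unit G k (fun j x hx => hG j x (by linarith [hx.1])) M hM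

theorem eulerMaclaurin_sum (G : ℕ → ℝ → E)
    (hG : ∀ j, ∀ x : ℝ, 0 < x → HasDerivAt (G j) (G (j + 1) x) x) (M : ℕ) (hM : 1 ≤ M)
    (hint : IntegrableOn (fun x => bernoulliDiv (2 * M) (Int.fract x) • G (2 * M + 1) x)
      (Set.Ioi 1)) (n : ℕ) (hn : 1 ≤ n) :
    ∑ k ∈ Finset.Icc 1 n, G 1 k = G 1 1 + eulerMaclaurinMain G M n - eulerMaclaurinMain G M 1
      - ∫ x in (1 : ℝ)..n, bernoulliDiv (2 * M) (Int.fract x) • G (2 * M + 1) x := by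
  have hii (a b : ℕ) (ha : 1 ≤ a) (hb : 1 ≤ b) : IntervalIntegrable
      (fun x => bernoulliDiv (2 * M) (Int.fract x) • G (2 * M + 1) x) volume (a : ℝ) b := by
    rw [intervalIntegrable_iff]
    refine hint.mono_set fun x hx => ?_
    have ha' : (1 : ℝ) ≤ a := by exact_mod_cast ha
    have hb' : (1 : ℝ) ≤ b := by exact_mod_cast hb
    exact lt_of_le_of_lt (le_min ha' hb') hx.1
  induction n, hn using Nat.le_induction with
  | base => simp
  | succ n hn ih =>
    have h1 := hii 1 n le_rfl hn
    rw [Nat.cast_one] at h1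
    rw [Finset.sum_Icc_succ_top (by omega), ih, eulerMaclaurin_step G hG M hM n hn,
      ← intervalIntegral.integral_add_adjacent_intervals h1 (hii n (n + 1) hn (by omega))]
    abel

end

/-! ### Sums of powers of the logarithm and their derivatives -/

/-- `∑_{r ≤ p} p!/(p-r)! · a_r · (log x)^{p-r}`: the `p`-th derivative at `0` of
`ε ↦ x^ε · ∑_r a_r ε^r`. -/
noncomputable def logSum (p : ℕ) (a : ℕ → ℝ) (x : ℝ) : ℝ :=
  ∑ r ∈ Finset.range (p + 1),
    (p.factorial : ℝ) / ((p - r).factorial : ℝ) * a r * Real.log x ^ (p - r)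

theorem hasDerivAt_logSum (p : ℕ) (a : ℕ → ℝ) {x : ℝ} (hx : 0 < x) :
    HasDerivAt (logSum p a) (logSum p (fun r => if r = 0 then 0 else a (r - 1)) x * x⁻¹) x := by
  have h : HasDerivAt (logSum p a) (∑ r ∈ Finset.range (p + 1),
      (p.factorial : ℝ) / ((p - r).factorial : ℝ) * a r
        * ((p - r : ℕ) * Real.log x ^ (p - r - 1) * x⁻¹)) x := by
    unfold logSum
    exact HasDerivAt.fun_sum fun r _ => ((Real.hasDerivAt_log hx.ne').pow (p - r)).const_mul _
  refine h.congr_deriv ?_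
  -- The term `r = p` has derivative zero and the shifted coefficient at `0` is zero; the others
  -- match under `r ↦ r + 1`.
  rw [logSum, Finset.sum_mul, Finset.sum_range_succ, Finset.sum_range_succ' (n := p)]
  simp only [Nat.sub_self, Nat.cast_zero, zero_mul, mul_zero, if_true, add_zero]
  refine Finset.sum_congr rfl fun r hr => ?_
  have hr' : r < p := Finset.mem_range.mp hr
  obtain ⟨s, rfl⟩ := Nat.exists_eq_add_of_lt hr'
  rw [show r + s + 1 - r = s + 1 by omega, show r + s + 1 - (r + 1) = s by omega,
    Nat.factorial_succ s]
  have h1 : (s.factorial : ℝ) ≠ 0 := by positivity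
  have h2 : (s : ℝ) + 1 ≠ 0 := by positivity
  simp only [Nat.add_sub_cancel, Nat.add_eq_zero_iff, one_ne_zero, and_false, if_false]
  push_cast
  field_simp

/-- In terms of the generating series `∑ a_r ε^r`, differentiating `x^(e+ε)` in `x` multiplies it by
`e + ε`. -/
theorem hasDerivAt_logSum_mul_zpow (p : ℕ) (a : ℕ → ℝ) (e : ℤ) {x : ℝ} (hx : 0 < x) :
    HasDerivAt (fun y => logSum p a y * y ^ e)
      (logSum p (fun r => (if r = 0 then 0 else a (r - 1)) + a r * e) x * x ^ (e - 1)) x := by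
  refine ((hasDerivAt_logSum p a hx).mul (hasDerivAt_zpow e x (Or.inl hx.ne'))).congr_deriv ?_
  have h : logSum p (fun r => (if r = 0 then 0 else a (r - 1)) + a r * e) x
      = logSum p (fun r => if r = 0 then 0 else a (r - 1)) x + logSum p a x * e := by
    simp only [logSum, Finset.sum_mul, ← Finset.sum_add_distrib]
    exact Finset.sum_congr rfl fun r _ => by ring
  rw [h, zpow_sub_one₀ hx.ne']
  ring

/-- `∏_{i < j} (X + q - i)`: the falling factorial of `q + X`. -/
noncomputable def fallingPoly (q j : ℕ) : Polynomial ℝ :=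
  ∏ i ∈ Finset.range j, (Polynomial.X + Polynomial.C ((q : ℝ) - i))

theorem fallingPoly_succ_coeff (q j r : ℕ) : (fallingPoly q (j + 1)).coeff r
    = (if r = 0 then 0 else (fallingPoly q j).coeff (r - 1))
      + (fallingPoly q j).coeff r * ((q : ℝ) - j) := by
  rw [fallingPoly, Finset.prod_range_succ, mul_add, Polynomial.coeff_add, Polynomial.coeff_mul_C]
  cases r with
  | zero => simp [fallingPoly]
  | succ r => simp [fallingPoly, Polynomial.coeff_mul_X]

/-- The primitive of `x^q (log x)^p`, followed by its successive derivatives, for `x > 0`. -/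
noncomputable def logPowDeriv (p q : ℕ) : ℕ → ℝ → ℝ
  | 0, x => logSum p (fun r => (-1) ^ r / ((q : ℝ) + 1) ^ (r + 1)) x * x ^ ((q : ℤ) + 1)
  | j + 1, x => logSum p (fallingPoly q j).coeff x * x ^ ((q : ℤ) - j)

theorem logSum_one (p : ℕ) (x : ℝ) :
    logSum p (fun r => if r = 0 then 1 else 0) x = Real.log x ^ p := by
  rw [logSum, Finset.sum_eq_single 0]
  · simp [div_self (show (p.factorial : ℝ) ≠ 0 by positivity)]
  · intro r _ hr
    simp [hr]
  · simp

theorem logPowDeriv_one (p q : ℕ) (x : ℝ) :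
    logPowDeriv p q 1 x = x ^ q * Real.log x ^ p := by
  have h : (fallingPoly q 0).coeff = fun r => if r = 0 then 1 else 0 := by
    ext r
    simp [fallingPoly, Polynomial.coeff_one]
  rw [logPowDeriv, h, logSum_one]
  simp [mul_comm]

theorem hasDerivAt_logPowDeriv (p q j : ℕ) {x : ℝ} (hx : 0 < x) :
    HasDerivAt (logPowDeriv p q j) (logPowDeriv p q (j + 1) x) x := by
  cases j with
  | zero =>
    refine (hasDerivAt_logSum_mul_zpow p _ ((q : ℤ) + 1) hx).congr_deriv ?_
    -- The geometric series: `(q + 1 + ε) ∑_r (-1)^r ε^r / (q+1)^(r+1) = 1`.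
    have h : (fun r : ℕ => (if r = 0 then (0 : ℝ) else (-1) ^ (r - 1) / ((q : ℝ) + 1) ^ (r - 1 + 1))
        + (-1) ^ r / ((q : ℝ) + 1) ^ (r + 1) * (((q : ℤ) + 1 : ℤ) : ℝ))
        = fun r => if r = 0 then 1 else 0 := by
      have hq : (q : ℝ) + 1 ≠ 0 := by positivity
      ext r
      cases r with
      | zero => simp; field_simp
      | succ r =>
        simp only [Nat.add_eq_zero_iff, one_ne_zero, and_false, if_false, Nat.add_sub_cancel]
        push_cast
        rw [pow_succ (q + 1 : ℝ) (r + 1), pow_succ (-1 : ℝ) r]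
        field_simp
        ring
    rw [h, logSum_one, logPowDeriv_one]
    simp [mul_comm]
  | succ j =>
    refine (hasDerivAt_logSum_mul_zpow p _ ((q : ℤ) - j) hx).congr_deriv ?_
    have h : (fun r => (if r = 0 then 0 else (fallingPoly q j).coeff (r - 1))
        + (fallingPoly q j).coeff r * (((q : ℤ) - j : ℤ) : ℝ)) = (fallingPoly q (j + 1)).coeff := by
      ext r
      rw [fallingPoly_succ_coeff]
      push_cast
      rfl
    rw [h, logPowDeriv]
    push_cast
    rw [sub_sub]

theorem iteratedDeriv_pow_mul_log_pow (p q j : ℕ) {x : ℝ} (hx : 0 < x) :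
    iteratedDeriv j (fun y : ℝ => y ^ q * Real.log y ^ p) x = logPowDeriv p q (j + 1) x := by
  induction j generalizing x with
  | zero => simp [logPowDeriv_one]
  | succ j ih =>
    rw [iteratedDeriv_succ]
    have h : iteratedDeriv j (fun y : ℝ => y ^ q * Real.log y ^ p)
        =ᶠ[nhds x] logPowDeriv p q (j + 1) := by
      filter_upwards [lt_mem_nhds hx] with y hy using ih hy
    rw [h.deriv_eq, (hasDerivAt_logPowDeriv p q (j + 1) hx).deriv]

/-! ### Coefficients of falling factorials -/

theorem coeff_prod_one_add_C_mul_X {ι : Type*} (s : Finset ι) (b : ι → ℝ) (r : ℕ) :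
    (∏ i ∈ s, (1 + Polynomial.C (b i) * Polynomial.X)).coeff r
      = ∑ A ∈ s.powersetCard r, ∏ i ∈ A, b i := by
  classical
  rw [Finset.prod_one_add, Polynomial.finsetSum_coeff]
  simp only [Finset.prod_mul_distrib, Finset.prod_const, ← map_prod,
    Polynomial.coeff_C_mul_X_pow]
  rw [Finset.powersetCard_eq_filter, Finset.sum_filter]
  exact Finset.sum_congr rfl fun A _ => by simp only [eq_comm]

/-- Reading `S` as a polynomial coefficient reduces the formulas for `c` and `d` to factorizations
of `fallingPoly`. The bound `h` excludes the default value of `S`. -/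
theorem S_natCast (r : ℕ) {s t : ℕ} (h : s ≤ t + 1) :
    S r s t = (∏ i ∈ Finset.Icc s t, (1 + Polynomial.C (1 / (i : ℝ)) * Polynomial.X)).coeff r := by
  rw [coeff_prod_one_add_C_mul_X, S, if_neg (by omega), Int.toNat_natCast]

theorem neg_one_pow_mul_S_natCast (r : ℕ) {s t : ℕ} (h : s ≤ t + 1) :
    (-1) ^ r * S r s t
      = (∏ i ∈ Finset.Icc s t, (1 + Polynomial.C (-1 / (i : ℝ)) * Polynomial.X)).coeff r := by
  rw [coeff_prod_one_add_C_mul_X, S, if_neg (by omega), Int.toNat_natCast, Finset.mul_sum]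
  refine Finset.sum_congr rfl fun A hA => ?_
  rw [← (Finset.mem_powersetCard.mp hA).2, ← Finset.prod_const, ← Finset.prod_mul_distrib]
  exact Finset.prod_congr rfl fun i _ => by ring

theorem fallingPoly_eq_of_le {q j : ℕ} (h : j ≤ q) :
    fallingPoly q j = Polynomial.C ((q.factorial : ℝ) / ((q - j).factorial : ℝ))
      * ∏ i ∈ Finset.Icc (q + 1 - j) q, (1 + Polynomial.C (1 / (i : ℝ)) * Polynomial.X) := by
  induction j with
  | zero => simp [fallingPoly, div_self (show (q.factorial : ℝ) ≠ 0 by positivity)]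
  | succ j ih =>
    obtain ⟨t, rfl⟩ := Nat.exists_eq_add_of_le h
    have e1 : j + 1 + t + 1 - j = t + 2 := by omega
    have e2 : j + 1 + t - j = t + 1 := by omega
    have e3 : j + 1 + t + 1 - (j + 1) = t + 1 := by omega
    have e4 : j + 1 + t - (j + 1) = t := by omega
    have e5 : ((j + 1 + t : ℕ) : ℝ) - j = t + 1 := by push_cast; ring
    rw [fallingPoly, Finset.prod_range_succ, ← fallingPoly, ih (by omega), e1, e2, e3, e4, e5,
      ← Finset.mul_prod_Ioc_eq_prod_Icc (a := t + 1) (by omega),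
      show Finset.Ioc (t + 1) (j + 1 + t) = Finset.Icc (t + 2) (j + 1 + t) by
        ext; simp; omega]
    have h2 : (t : ℝ) + 1 ≠ 0 := by positivity
    have e6 : (Polynomial.X + Polynomial.C ((t : ℝ) + 1) : Polynomial ℝ)
        = Polynomial.C ((t : ℝ) + 1)
          * (1 + Polynomial.C (1 / ((t + 1 : ℕ) : ℝ)) * Polynomial.X) := by
      rw [mul_add, ← mul_assoc, ← Polynomial.C_mul]
      push_cast
      rw [mul_one_div_cancel h2]
      simp [add_comm]
    have e7 : ((j + 1 + t).factorial : ℝ) / (t.factorial : ℝ)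
        = ((j + 1 + t).factorial : ℝ) / ((t + 1).factorial : ℝ) * ((t : ℝ) + 1) := by
      have h1 : (t.factorial : ℝ) ≠ 0 := by positivity
      rw [Nat.factorial_succ t]
      push_cast
      field_simp
    rw [e6, e7, Polynomial.C_mul]
    ring

/-- The factor `i = q` is `X`; the `t` later factors `X - 1, …, X - t` contribute `(-1)^t t!` and
reciprocals of negative sign. -/
theorem fallingPoly_eq_of_lt (q t : ℕ) :
    fallingPoly q (q + 1 + t) = Polynomial.C ((q.factorial : ℝ) * ((-1) ^ t * (t.factorial : ℝ)))
      * (Polynomial.X * ((∏ i ∈ Finset.Icc 1 q, (1 + Polynomial.C (1 / (i : ℝ)) * Polynomial.X))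
        * ∏ i ∈ Finset.Icc 1 t, (1 + Polynomial.C (-1 / (i : ℝ)) * Polynomial.X))) := by
  induction t with
  | zero =>
    rw [add_zero, fallingPoly, Finset.prod_range_succ, ← fallingPoly, fallingPoly_eq_of_le le_rfl]
    simp
    ring
  | succ t ih =>
    have h2 : (t : ℝ) + 1 ≠ 0 := by positivity
    have e5 : (q : ℝ) - (q + 1 + t : ℕ) = -(t + 1) := by push_cast; ring
    have e6 : (Polynomial.X + Polynomial.C (-((t : ℝ) + 1)) : Polynomial ℝ)
        = Polynomial.C (-((t : ℝ) + 1))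
          * (1 + Polynomial.C (-1 / ((t + 1 : ℕ) : ℝ)) * Polynomial.X) := by
      rw [mul_add, ← mul_assoc, ← Polynomial.C_mul]
      push_cast
      rw [show -((t : ℝ) + 1) * (-1 / ((t : ℝ) + 1)) = 1 by field_simp]
      simp [add_comm]
    rw [show q + 1 + (t + 1) = q + 1 + t + 1 by ring, fallingPoly, Finset.prod_range_succ,
      ← fallingPoly, ih, e5, e6, Finset.prod_Icc_succ_top (by omega), Nat.factorial_succ]
    rw [show (q.factorial : ℝ) * ((-1) ^ (t + 1) * (((t + 1) * t.factorial : ℕ) : ℝ))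
      = (q.factorial : ℝ) * ((-1) ^ t * (t.factorial : ℝ)) * (-((t : ℝ) + 1)) by
        push_cast; ring, Polynomial.C_mul (b := -((t : ℝ) + 1))]
    ring

theorem fallingPoly_coeff_zero_of_lt {q j : ℕ} (h : q < j) : (fallingPoly q j).coeff 0 = 0 := by
  obtain ⟨t, rfl⟩ := Nat.exists_eq_add_of_le (Nat.succ_le_of_lt h)
  rw [Nat.succ_eq_add_one, fallingPoly_eq_of_lt]
  simp

theorem c_eq (p q k r : ℕ) (hk : 1 ≤ k) (hkq : 2 * k ≤ q + 1) :
    c p q k r = (bernoulli (2 * k) : ℝ) / ((2 * k).factorial : ℝ)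
      * ((p.factorial : ℝ) / ((p - r).factorial : ℝ) * (fallingPoly q (2 * k - 1)).coeff r) := by
  rw [fallingPoly_eq_of_le (by omega), Polynomial.coeff_C_mul,
    show q + 1 - (2 * k - 1) = q + 2 - 2 * k by omega, ← S_natCast r (by omega),
    show q - (2 * k - 1) = q + 1 - 2 * k by omega, c]
  ring

theorem prod_range_two_mul_sub (q t k : ℕ) (h : 2 * k = q + 2 + t) :
    ∏ i ∈ Finset.range (q + 2), (2 * (k : ℝ) - (i : ℝ))
      = ((2 * k).factorial : ℝ) / (t.factorial : ℝ) := by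
  have h0 : (2 * (k : ℝ)) = ((q + 2 + t : ℕ) : ℝ) := by exact_mod_cast h
  rw [h, h0]
  have h1 : (t.factorial : ℝ) ≠ 0 := by positivity
  rw [eq_div_iff h1]
  have key : ∀ m : ℕ, (∏ i ∈ Finset.range m, (((m + t : ℕ) : ℝ) - (i : ℝ))) * (t.factorial : ℝ)
      = ((m + t).factorial : ℝ) := by
    intro m
    induction m with
    | zero => simp
    | succ m ih =>
      rw [Finset.prod_range_succ', show m + 1 + t = m + t + 1 by ring, Nat.factorial_succ]
      push_cast at ih ⊢
      simp only [add_sub_add_right_eq_sub, sub_zero]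
      rw [← ih]
      ring
  exact key (q + 2)

theorem S_of_neg {r : ℤ} (hr : r < 0) (s t : ℕ) : S r s t = 0 := by
  rw [S, if_pos (Or.inl hr)]

theorem S_eq_zero_of_lt {r t : ℕ} (h : t < r) : S r 1 t = 0 := by
  rw [S, if_neg (by omega), Int.toNat_natCast, Finset.powersetCard_eq_empty.2 (by simpa using h),
    Finset.sum_empty]

theorem d_eq (p q k r : ℕ) (hkq : q + 2 ≤ 2 * k) (hr : 1 ≤ r) :
    d p q k r = (bernoulli (2 * k) : ℝ) / ((2 * k).factorial : ℝ)
      * ((p.factorial : ℝ) / ((p - r).factorial : ℝ) * (fallingPoly q (2 * k - 1)).coeff r) := by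
  obtain ⟨t, ht⟩ := Nat.exists_eq_add_of_le hkq
  obtain ⟨r, rfl⟩ := Nat.exists_eq_add_of_le' hr
  rw [show 2 * k - 1 = q + 1 + t by omega, fallingPoly_eq_of_lt, Polynomial.coeff_C_mul,
    Polynomial.coeff_X_mul, Polynomial.coeff_mul, d, prod_range_two_mul_sub q t k ht,
    show 2 * k - q - 2 = t by omega]
  -- `q + t = 2k - 2` is even.
  have hpar : (-1 : ℝ) ^ q = (-1) ^ t := by
    have : q + t = 2 * (k - 1) := by omega
    have h1 : (-1 : ℝ) ^ q * (-1) ^ t = 1 := by rw [← pow_add, this, pow_mul]; simp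
    have h2 : (-1 : ℝ) ^ t * (-1) ^ t = 1 := by rw [← mul_pow]; simp
    calc (-1 : ℝ) ^ q = (-1) ^ q * (-1) ^ t * (-1) ^ t := by rw [mul_assoc, h2, mul_one]
      _ = _ := by rw [h1, one_mul]
  -- The sum in `d` runs to `q`, the Cauchy product to `r`. The surplus terms vanish: `S j 1 q = 0`
  -- for `j > q`, and the second `S` has negative index for `j > r`.
  have hsum : ∑ j ∈ Finset.range (q + 1), (-1 : ℝ) ^ j * S j 1 q
      * S (((r + 1 : ℕ) : ℤ) - j - 1) 1 t
      = ∑ j ∈ Finset.range (r + 1), (-1 : ℝ) ^ j * S j 1 q * S ((r - j : ℕ) : ℤ) 1 t := by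
    have hA : ∀ j ∈ Finset.range (r + 1), S (((r + 1 : ℕ) : ℤ) - j - 1) 1 t
        = S ((r - j : ℕ) : ℤ) 1 t := by
      intro j hj
      rw [Finset.mem_range] at hj
      rw [show ((r + 1 : ℕ) : ℤ) - j - 1 = ((r - j : ℕ) : ℤ) by omega]
    rw [Finset.sum_congr rfl fun (j : ℕ) hj => congrArg 
      (fun y => (-1 : ℝ) ^ j * S j 1 q * y) (hA j hj).symm]
    rcases le_total q r with hqr | hqr
    · refine Finset.sum_subset (Finset.range_mono (by omega)) fun j _ hj => ?_
      rw [Finset.mem_range] at hj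
      rw [S_eq_zero_of_lt (by omega)]
      ring
    · symm
      refine Finset.sum_subset (Finset.range_mono (by omega)) fun j _ hj => ?_
      rw [Finset.mem_range] at hj
      rw [S_of_neg (show ((r + 1 : ℕ) : ℤ) - j - 1 < 0 by omega)]
      ring
  rw [hsum, Finset.Nat.sum_antidiagonal_eq_sum_range_succ_mk, Finset.mul_sum, Finset.mul_sum,
    Finset.mul_sum, Finset.mul_sum]
  refine Finset.sum_congr rfl fun j hj => ?_
  rw [Finset.mem_range] at hj
  simp only
  rw [← S_natCast j (by omega), ← neg_one_pow_mul_S_natCast (r - j) (by omega)]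
  have hsign : (-1 : ℝ) ^ (r + 1 + q + 1) * (-1) ^ j = (-1) ^ t * (-1) ^ (r - j) := by
    obtain ⟨u, rfl⟩ := Nat.exists_eq_add_of_le (Nat.lt_succ_iff.mp hj)
    rw [Nat.add_sub_cancel_left, ← hpar]
    have h2 : (-1 : ℝ) ^ j * (-1) ^ j = 1 := by rw [← mul_pow]; simp
    linear_combination (-1 : ℝ) ^ u * (-1) ^ q * h2
  have hf : (t.factorial : ℝ) ≠ 0 := by positivity
  have hf2 : ((2 * k).factorial : ℝ) ≠ 0 := by positivity
  have hf3 : ((p - (r + 1)).factorial : ℝ) ≠ 0 := by positivity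
  field_simp
  linear_combination ((bernoulli (2 * k) : ℝ) * S (j : ℤ) 1 q * S ((r - j : ℕ) : ℤ) 1 t) * hsign

/-! ### The boundary terms as the explicit expansion -/

theorem bernoulli_mul_logPowDeriv_of_le (p q k : ℕ) (hk : 1 ≤ k) (hkq : 2 * k ≤ q + 1) (x : ℝ) :
    (bernoulli (2 * k) : ℝ) / ((2 * k).factorial : ℝ) * logPowDeriv p q (2 * k) x
      = (∑ r ∈ Finset.range (p + 1), c p q k r * Real.log x ^ (p - r)) * x ^ (q + 1 - 2 * k) := by
  obtain ⟨j, hj⟩ := Nat.exists_eq_add_of_le' (show 1 ≤ 2 * k by omega)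
  rw [Finset.sum_congr rfl fun r _ => by rw [c_eq p q k r hk hkq], hj, logPowDeriv, logSum,
    ← zpow_natCast, show ((q + 1 - (j + 1) : ℕ) : ℤ) = (q : ℤ) - j by omega, ← mul_assoc,
    Finset.mul_sum, Nat.add_sub_cancel]
  congr 1
  exact Finset.sum_congr rfl fun r _ => by ring

theorem bernoulli_mul_logPowDeriv_of_lt (p q k : ℕ) (hkq : q + 2 ≤ 2 * k) (x : ℝ) :
    (bernoulli (2 * k) : ℝ) / ((2 * k).factorial : ℝ) * logPowDeriv p q (2 * k) x
      = (∑ r ∈ Finset.Icc 1 p, d p q k r * Real.log x ^ (p - r)) / x ^ (2 * k - q - 1) := by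
  obtain ⟨j, hj⟩ := Nat.exists_eq_add_of_le' (show 1 ≤ 2 * k by omega)
  have h0 : logSum p (fallingPoly q j).coeff x = ∑ r ∈ Finset.Icc 1 p,
      (p.factorial : ℝ) / ((p - r).factorial : ℝ) * (fallingPoly q j).coeff r
        * Real.log x ^ (p - r) := by
    rw [logSum]
    symm
    refine Finset.sum_subset (fun r hr => ?_) fun r _ hr => ?_
    · rw [Finset.mem_Icc] at hr
      exact Finset.mem_range.2 (by omega)
    · rw [Finset.mem_Icc] at hr
      have : r = 0 := by
        have := Finset.mem_range.1 ‹r ∈ Finset.range (p + 1)›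
        omega
      rw [this, fallingPoly_coeff_zero_of_lt (by omega)]
      ring
  rw [Finset.sum_congr rfl fun r hr => by rw [d_eq p q k r hkq (Finset.mem_Icc.1 hr).1], hj,
    logPowDeriv, h0, Nat.add_sub_cancel, div_eq_mul_inv _ (x ^ _), ← zpow_natCast, ← zpow_neg,
    show -((j + 1 - q - 1 : ℕ) : ℤ) = (q : ℤ) - j by omega, ← mul_assoc, Finset.mul_sum]
  congr 1
  exact Finset.sum_congr rfl fun r _ => by ring

/-- The term of the expansion with positive powers that does not depend on `n`. -/
theorem sum_constant_terms (p q : ℕ) (hp : 1 ≤ p) :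
    ∑ k ∈ Finset.Icc 1 ((q + 1) / 2), (if 2 * k = q + 1 then c p q k p else 0)
      = (bernoulli (q + 1) : ℝ) / ((q : ℝ) + 1) * (p.factorial : ℝ) * S p 1 q := by
  rcases Nat.even_or_odd' q with ⟨u, rfl | rfl⟩
  · rw [Finset.sum_eq_zero fun k _ => if_neg (by omega)]
    -- For even `q > 0` one has `B_{q+1} = 0`. For `q = 0` this fails, as `B_1 ≠ 0`, but then
    -- `S_{p,1,0} = 0` because `p ≥ 1`.
    rcases Nat.eq_zero_or_pos u with rfl | hu
    · rw [mul_zero, S_eq_zero_of_lt (by omega), mul_zero]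
    · rw [bernoulli_eq_zero_of_odd ⟨u, rfl⟩ (by omega)]
      simp
  · rw [Finset.sum_eq_single (u + 1)]
    · rw [if_pos (by ring), c, show 2 * (u + 1) = 2 * u + 1 + 1 by ring, Nat.sub_self,
        Nat.sub_self, show 2 * u + 1 + 2 - (2 * u + 1 + 1) = 1 by omega,
        Nat.factorial_succ (2 * u + 1)]
      have h : ((2 * u + 1).factorial : ℝ) ≠ 0 := by positivity
      have h2 : (2 * (u : ℝ) + 1 + 1) ≠ 0 := by positivity
      push_cast
      simp only [Nat.factorial_zero, Nat.cast_one, div_one]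
      field_simp
    · exact fun k _ hk => if_neg (by omega)
    · exact fun h => absurd (Finset.mem_Icc.2 ⟨by omega, by omega⟩) h

theorem eulerMaclaurinMain_logPowDeriv (p q M n : ℕ) (hp : 1 ≤ p) (hM : (q + 1) / 2 ≤ M) :
    eulerMaclaurinMain (logPowDeriv p q) M n = expansion p q M n
      + (bernoulli (q + 1) : ℝ) / ((q : ℝ) + 1) * (p.factorial : ℝ) * S p 1 q := by
  have hmid : ∑ k ∈ Finset.Icc 1 ((q + 1) / 2),
        (∑ r ∈ Finset.range (p + 1),
          if 2 * k = q + 1 ∧ r = p then 0 else c p q k r * Real.log n ^ (p - r))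
          * (n : ℝ) ^ (q + 1 - 2 * k)
      = ∑ k ∈ Finset.Icc 1 ((q + 1) / 2),
          (bernoulli (2 * k) : ℝ) / ((2 * k).factorial : ℝ) * logPowDeriv p q (2 * k) n
        - (bernoulli (q + 1) : ℝ) / ((q : ℝ) + 1) * (p.factorial : ℝ) * S p 1 q := by
    rw [← sum_constant_terms p q hp, ← Finset.sum_sub_distrib]
    refine Finset.sum_congr rfl fun k hk => ?_
    rw [Finset.mem_Icc] at hk
    rw [bernoulli_mul_logPowDeriv_of_le p q k hk.1 (by omega)]
    by_cases h : 2 * k = q + 1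
    · rw [Finset.sum_range_succ, Finset.sum_range_succ (n := p)]
      rw [Finset.sum_congr rfl fun r hr =>
        if_neg (show ¬(2 * k = q + 1 ∧ r = p) from fun h' => by
          have := Finset.mem_range.1 hr
          omega)]
      simp [h]
    · simp [h]
  have hlast : ∑ k ∈ Finset.Icc ((q + 1) / 2 + 1) M,
        (∑ r ∈ Finset.Icc 1 p, d p q k r * Real.log n ^ (p - r)) / (n : ℝ) ^ (2 * k - q - 1)
      = ∑ k ∈ Finset.Icc ((q + 1) / 2 + 1) M,
          (bernoulli (2 * k) : ℝ) / ((2 * k).factorial : ℝ) * logPowDeriv p q (2 * k) n := by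
    refine Finset.sum_congr rfl fun k hk => ?_
    rw [Finset.mem_Icc] at hk
    rw [bernoulli_mul_logPowDeriv_of_lt p q k (by omega)]
  have hsplit : ∑ k ∈ Finset.Icc 1 M,
        (bernoulli (2 * k) : ℝ) / ((2 * k).factorial : ℝ) * logPowDeriv p q (2 * k) n
      = ∑ k ∈ Finset.Icc 1 ((q + 1) / 2),
          (bernoulli (2 * k) : ℝ) / ((2 * k).factorial : ℝ) * logPowDeriv p q (2 * k) n
        + ∑ k ∈ Finset.Icc ((q + 1) / 2 + 1) M,
          (bernoulli (2 * k) : ℝ) / ((2 * k).factorial : ℝ) * logPowDeriv p q (2 * k) n := by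
    rw [← Finset.sum_union]
    · congr 1
      ext k
      simp only [Finset.mem_union, Finset.mem_Icc]
      omega
    · rw [Finset.disjoint_left]
      intro k hk hk'
      rw [Finset.mem_Icc] at hk hk'
      omega
  have h0 : logPowDeriv p q 0 n = (n : ℝ) ^ (q + 1) * ∑ r ∈ Finset.range (p + 1),
      (-1) ^ r * (p.factorial : ℝ) / ((p - r).factorial : ℝ)
        * (Real.log n ^ (p - r) / ((q : ℝ) + 1) ^ (r + 1)) := by
    rw [logPowDeriv, logSum, mul_comm]
    congr 1
    exact Finset.sum_congr rfl fun r _ => by ring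
  rw [expansion, hmid, hlast, eulerMaclaurinMain, h0, logPowDeriv_one]
  simp only [smul_eq_mul]
  rw [hsplit]
  ring

/-- At `n = 1` all logarithms vanish, so only `r = p` survives. The range of the `c` shortens from
`⌈q/2⌉` to `⌊q/2⌋` because for odd `q` the last such term is the one left out. -/
theorem expansion_one (p q M : ℕ) (hp : 1 ≤ p) :
    expansion p q M 1 = -((-1) ^ (p + 1) * (p.factorial : ℝ) / ((q : ℝ) + 1) ^ (p + 1)
      - ∑ k ∈ Finset.Icc 1 (q / 2), c p q k p
      - ∑ k ∈ Finset.Icc ((q + 1) / 2 + 1) M, d p q k p) := by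
  have hr (g : ℕ → ℝ) : ∑ r ∈ Finset.range (p + 1), g r * (0 : ℝ) ^ (p - r) = g p := by
    rw [Finset.sum_range_succ, Finset.sum_eq_zero]
    · simp
    · intro r hr
      have := Finset.mem_range.1 hr
      rw [zero_pow (by omega), mul_zero]
  have hr' (g : ℕ → ℝ) : ∑ r ∈ Finset.Icc 1 p, g r * (0 : ℝ) ^ (p - r) = g p := by
    rw [Finset.sum_eq_single p]
    · simp
    · intro r hr hne
      rw [Finset.mem_Icc] at hr
      rw [zero_pow (by omega), mul_zero]
    · exact fun h => absurd (Finset.mem_Icc.2 ⟨hp, le_rfl⟩) h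
  have hmid : ∑ k ∈ Finset.Icc 1 ((q + 1) / 2), (∑ r ∈ Finset.range (p + 1),
        if 2 * k = q + 1 ∧ r = p then 0 else c p q k r * (0 : ℝ) ^ (p - r))
      = ∑ k ∈ Finset.Icc 1 (q / 2), c p q k p := by
    have h1 (k : ℕ) : (∑ r ∈ Finset.range (p + 1),
        if 2 * k = q + 1 ∧ r = p then 0 else c p q k r * (0 : ℝ) ^ (p - r))
        = if 2 * k = q + 1 then 0 else c p q k p := by
      have h := hr fun r => if 2 * k = q + 1 ∧ r = p then 0 else c p q k r
      simpa only [and_true, ite_mul, zero_mul] using h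
    simp only [h1]
    symm
    refine Finset.sum_subset_zero_on_sdiff (Finset.Icc_subset_Icc le_rfl (by omega)) ?_ ?_
    · intro k hk
      simp only [Finset.mem_sdiff, Finset.mem_Icc] at hk
      exact if_pos (by omega)
    · intro k hk
      rw [Finset.mem_Icc] at hk
      exact (if_neg (by omega)).symm
  have h0 : ∑ r ∈ Finset.range (p + 1), (-1) ^ r * (p.factorial : ℝ) / ((p - r).factorial : ℝ)
        * ((0 : ℝ) ^ (p - r) / ((q : ℝ) + 1) ^ (r + 1))
      = (-1) ^ p * (p.factorial : ℝ) / ((q : ℝ) + 1) ^ (p + 1) := by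
    rw [← Finset.sum_congr rfl fun r _ => show (-1) ^ r * (p.factorial : ℝ)
      / ((p - r).factorial : ℝ) / ((q : ℝ) + 1) ^ (r + 1) * (0 : ℝ) ^ (p - r) = _ by ring]
    rw [hr]
    simp
  rw [expansion]
  simp only [Nat.cast_one, Real.log_one, one_pow, mul_one, div_one, one_mul, hr', hmid, h0]
  rw [zero_pow (by omega)]
  ring

/-! ### The remainder integral -/

theorem remainderIntegrand_eq (p q M : ℕ) {x : ℝ} (hx : 0 < x) :
    remainderIntegrand p q M x
      = bernoulliDiv (2 * M) (Int.fract x) • logPowDeriv p q (2 * M + 1) x := by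
  rw [remainderIntegrand, iteratedDeriv_pow_mul_log_pow p q (2 * M) hx, bernoulliDiv, smul_eq_mul]

/-- Half a power of `x` is affordable: `2M ≥ q + 2` gives `q - 2M + 1/2 ≤ -3/2`, still integrable at
infinity. -/
theorem exists_logSum_le_rpow (p : ℕ) (a : ℕ → ℝ) :
    ∃ C : ℝ, ∀ x : ℝ, 1 ≤ x → |logSum p a x| ≤ C * x ^ (1 / 2 : ℝ) := by
  refine ⟨∑ r ∈ Finset.range (p + 1),
    |(p.factorial : ℝ) / ((p - r).factorial : ℝ) * a r| * (2 * (p + 1 : ℝ)) ^ (p - r),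
    fun x hx => ?_⟩
  rw [logSum, Finset.sum_mul]
  refine (Finset.abs_sum_le_sum_abs _ _).trans (Finset.sum_le_sum fun r _ => ?_)
  rw [abs_mul, mul_assoc]
  refine mul_le_mul_of_nonneg_left ?_ (abs_nonneg _)
  have hx0 : 0 ≤ x := by linarith
  have hlog : 0 ≤ Real.log x := Real.log_nonneg hx
  rw [abs_of_nonneg (by positivity)]
  -- With this exponent, `p - r` factors of the bound for `log x` multiply to at most a constant
  -- times `x^(1/2)`.
  have hε : (0 : ℝ) < 1 / (2 * (p + 1 : ℝ)) := by positivity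
  have h1 : Real.log x ≤ (2 * (p + 1 : ℝ)) * x ^ (1 / (2 * (p + 1 : ℝ))) := by
    have := Real.log_le_rpow_div hx0 hε
    rwa [div_div_eq_mul_div, div_one, mul_comm] at this
  refine (pow_le_pow_left₀ hlog h1 (p - r)).trans ?_
  rw [mul_pow, ← Real.rpow_mul_natCast hx0]
  refine mul_le_mul_of_nonneg_left (Real.rpow_le_rpow_of_exponent_le hx ?_) (by positivity)
  have h2 : ((p - r : ℕ) : ℝ) ≤ p + 1 := by
    have : p - r ≤ p + 1 := by omega
    exact_mod_cast this
  rw [one_div_mul_eq_div, div_le_iff₀ (by positivity)]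
  linarith

theorem exists_remainderIntegrand_le (p q M : ℕ) :
    ∃ C : ℝ, ∀ x : ℝ, 1 ≤ x →
      |remainderIntegrand p q M x| ≤ C * x ^ ((q : ℝ) - 2 * M + 1 / 2) := by
  obtain ⟨C₁, hC₁, hB⟩ := exists_abs_bernoulliDiv_le (2 * M)
  obtain ⟨C₂, hL⟩ := exists_logSum_le_rpow p (fallingPoly q (2 * M)).coeff
  refine ⟨C₁ * C₂, fun x hx => ?_⟩
  have hx0 : 0 < x := by linarith
  rw [remainderIntegrand_eq p q M hx0, smul_eq_mul, abs_mul, mul_assoc]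
  refine mul_le_mul (hB _ ⟨Int.fract_nonneg x, (Int.fract_lt_one x).le⟩) ?_ (abs_nonneg _) hC₁.le
  rw [logPowDeriv, abs_mul, abs_of_pos (zpow_pos hx0 _), add_comm _ (1 / 2 : ℝ),
    Real.rpow_add hx0, ← mul_assoc]
  refine mul_le_mul (hL x hx) (le_of_eq ?_) (zpow_pos hx0 _).le ((abs_nonneg _).trans (hL x hx))
  rw [← Real.rpow_intCast]
  push_cast
  rfl

theorem continuousOn_logPowDeriv (p q j : ℕ) : ContinuousOn (logPowDeriv p q j) (Set.Ioi 0) :=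
  fun _ hx => (hasDerivAt_logPowDeriv p q j hx).continuousAt.continuousWithinAt

theorem integrableOn_remainderIntegrand (p q M : ℕ) (hM : (q + 1) / 2 + 1 ≤ M) :
    IntegrableOn (remainderIntegrand p q M) (Set.Ioi 1) := by
  obtain ⟨C, hC⟩ := exists_remainderIntegrand_le p q M
  have hexp : (q : ℝ) - 2 * M + 1 / 2 < -1 := by
    have : q + 2 ≤ 2 * M := by omega
    have : (q : ℝ) + 2 ≤ 2 * M := by exact_mod_cast this
    linarith
  refine ((integrableOn_Ioi_rpow_of_lt hexp one_pos).const_mul C).mono' ?_ ?_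
  · have h : AEStronglyMeasurable (fun x => bernoulliDiv (2 * M) (Int.fract x)
        • logPowDeriv p q (2 * M + 1) x) (volume.restrict (Set.Ioi 1)) := by
      have hB : AEStronglyMeasurable (fun x => bernoulliDiv (2 * M) (Int.fract x))
          (volume.restrict (Set.Ioi 1)) :=
        ((continuous_bernoulliDiv _).measurable.comp measurable_fract).aestronglyMeasurable
      exact hB.smul (((continuousOn_logPowDeriv p q _).mono
        (Set.Ioi_subset_Ioi zero_le_one)).aestronglyMeasurable measurableSet_Ioi)
    refine h.congr ?_
    filter_upwards [ae_restrict_mem measurableSet_Ioi] with x hx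
    exact (remainderIntegrand_eq p q M (zero_lt_one.trans hx)).symm
  · filter_upwards [ae_restrict_mem measurableSet_Ioi] with x hx
    exact hC x (le_of_lt hx)

/-- The exponent `q - 2M + 3/2` is rounded up to an integer; nothing is lost, since the error
estimate takes `M` larger than `m`. -/
theorem exists_integral_remainderIntegrand_le (p q M : ℕ) (hM : (q + 1) / 2 + 1 ≤ M) :
    ∃ C : ℝ, ∀ n : ℕ, 1 ≤ n → |∫ x in Set.Ioi (n : ℝ), remainderIntegrand p q M x|
      ≤ C * (n : ℝ) ^ ((q : ℤ) - 2 * M + 2) := by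
  obtain ⟨C, hC⟩ := exists_remainderIntegrand_le p q M
  have hC0 : 0 ≤ C := by simpa using (abs_nonneg _).trans (hC 1 le_rfl)
  have hexp : (q : ℝ) - 2 * M + 1 / 2 < -1 := by
    have : q + 2 ≤ 2 * M := by omega
    have : (q : ℝ) + 2 ≤ 2 * M := by exact_mod_cast this
    linarith
  refine ⟨C * (1 / (-((q : ℝ) - 2 * M + 1 / 2 + 1))), fun n hn => ?_⟩
  have hn1 : (1 : ℝ) ≤ n := by exact_mod_cast hn
  have hn0 : (0 : ℝ) < n := by linarith
  have hint := (integrableOn_Ioi_rpow_of_lt hexp hn0).const_mul C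
  have h1 : |∫ x in Set.Ioi (n : ℝ), remainderIntegrand p q M x|
      ≤ ∫ x in Set.Ioi (n : ℝ), C * x ^ ((q : ℝ) - 2 * M + 1 / 2) := by
    rw [← Real.norm_eq_abs]
    refine norm_integral_le_of_norm_le hint ?_
    filter_upwards [ae_restrict_mem measurableSet_Ioi] with x hx
    exact hC x (hn1.trans (le_of_lt hx))
  refine h1.trans ?_
  rw [integral_const_mul, integral_Ioi_rpow_of_lt hexp hn0, mul_assoc, neg_div, ← div_neg,
    div_eq_mul_one_div, mul_comm _ (1 / _)]
  refine mul_le_mul_of_nonneg_left (mul_le_mul_of_nonneg_left ?_ ?_) hC0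
  · rw [← Real.rpow_intCast]
    refine Real.rpow_le_rpow_of_exponent_le hn1 ?_
    push_cast
    linarith
  · rw [one_div_nonneg]
    linarith

/-- The constant of the Euler–Maclaurin formula of order `2M`. -/
noncomputable def constantOfOrder (p q M : ℕ) : ℝ :=
  -expansion p q M 1 - ∫ x in Set.Ioi (1 : ℝ), remainderIntegrand p q M x

theorem sum_pow_mul_log_pow_eq (p q M n : ℕ) (hp : 1 ≤ p) (hM : (q + 1) / 2 + 1 ≤ M)
    (hn : 1 ≤ n) :
    ∑ k ∈ Finset.Icc 1 n, (k : ℝ) ^ q * Real.log k ^ p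
      = expansion p q M n + constantOfOrder p q M
        + ∫ x in Set.Ioi (n : ℝ), remainderIntegrand p q M x := by
  have hint := integrableOn_remainderIntegrand p q M hM
  have hn1 : (1 : ℝ) ≤ n := by exact_mod_cast hn
  have heq : Set.EqOn (remainderIntegrand p q M) (fun x => bernoulliDiv (2 * M) (Int.fract x)
      • logPowDeriv p q (2 * M + 1) x) (Set.Ioi 1) :=
    fun x hx => remainderIntegrand_eq p q M (zero_lt_one.trans hx)
  have h := eulerMaclaurin_sum (logPowDeriv p q) (fun j x hx => hasDerivAt_logPowDeriv p q j hx) M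
    (by omega) (hint.congr_fun heq measurableSet_Ioi) n hn
  have h1 := eulerMaclaurinMain_logPowDeriv p q M 1 hp (by omega)
  rw [Nat.cast_one] at h1
  have h2 : ∫ x in (1 : ℝ)..n, bernoulliDiv (2 * M) (Int.fract x) • logPowDeriv p q (2 * M + 1) x
      = ∫ x in (1 : ℝ)..n, remainderIntegrand p q M x := by
    rw [intervalIntegral.integral_of_le hn1, intervalIntegral.integral_of_le hn1]
    exact setIntegral_congr_fun measurableSet_Ioc fun x hx => (heq hx.1).symm
  have h3 : ∫ x in (1 : ℝ)..n, remainderIntegrand p q M x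
      = (∫ x in Set.Ioi (1 : ℝ), remainderIntegrand p q M x)
        - ∫ x in Set.Ioi (n : ℝ), remainderIntegrand p q M x := by
    rw [intervalIntegral.integral_Ioi_sub_Ioi hint hn1]
  simp only [logPowDeriv_one] at h
  -- The `n`-independent boundary term cancels between `n` and `1`, and the summand at `k = 1` is
  -- zero because `p ≥ 1`.
  rw [h, h1, h2, h3, eulerMaclaurinMain_logPowDeriv p q M n hp (by omega), constantOfOrder,
    Real.log_one, zero_pow (by omega)]
  ring

/-! ### Complex powers and their derivatives in the exponent -/

/-- The primitive of `x ↦ x^w`, followed by its successive derivatives, for `x > 0`. -/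
noncomputable def cpowDeriv (w : ℂ) : ℕ → ℝ → ℂ
  | 0, x => (w + 1)⁻¹ * (x : ℂ) ^ (w + 1)
  | j + 1, x => (∏ i ∈ Finset.range j, (w - i)) * (x : ℂ) ^ (w - j)

theorem cpowDeriv_one (w : ℂ) (x : ℝ) : cpowDeriv w 1 x = (x : ℂ) ^ w := by
  simp [cpowDeriv]

theorem hasDerivAt_cpowDeriv {w : ℂ} (hw : w ≠ -1) (j : ℕ) {x : ℝ} (hx : 0 < x) :
    HasDerivAt (cpowDeriv w j) (cpowDeriv w (j + 1) x) x := by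
  cases j with
  | zero =>
    rw [zero_add, cpowDeriv_one]
    refine (hasDerivAt_ofReal_cpow_const' hx.ne' hw).congr_of_eventuallyEq
      (Eventually.of_forall fun y => ?_)
    simp only [cpowDeriv, div_eq_inv_mul]
  | succ j =>
    rw [cpowDeriv, Finset.prod_range_succ]
    -- If `w = j` the power is constant in `x`, and the next product contains the zero factor `w -
    -- j`.
    by_cases h : w - j = 0
    · rw [h, mul_zero, zero_mul]
      refine (hasDerivAt_const x (∏ i ∈ Finset.range j, (w - i))).congr_of_eventuallyEq
        (Eventually.of_forall fun y => ?_)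
      rw [cpowDeriv, h, Complex.cpow_zero, mul_one]
    · refine ((hasDerivAt_ofReal_cpow_const hx.ne' h).const_mul
        (∏ i ∈ Finset.range j, (w - i))).congr_deriv ?_
      push_cast
      rw [mul_assoc, sub_sub]

theorem analyticAt_const_cpow_add {x : ℝ} (hx : 0 < x) (b w : ℂ) :
    AnalyticAt ℂ (fun z : ℂ => (x : ℂ) ^ (z + b)) w :=
  analyticAt_const.cpow (analyticAt_id.add analyticAt_const)
    (Or.inl (by simpa using hx))

theorem analyticAt_cpowDeriv {w : ℂ} (hw : w ≠ -1) (j : ℕ) {x : ℝ} (hx : 0 < x) :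
    AnalyticAt ℂ (fun z : ℂ => cpowDeriv z j x) w := by
  cases j with
  | zero =>
    exact ((analyticAt_id.add analyticAt_const).inv
      (fun h => hw (eq_neg_of_add_eq_zero_left h))).mul (analyticAt_const_cpow_add hx 1 w)
  | succ j =>
    have h1 : AnalyticAt ℂ (fun z : ℂ => ∏ i ∈ Finset.range j, (z - i)) w :=
      Finset.analyticAt_fun_prod _ fun i _ => analyticAt_id.sub analyticAt_const
    have h2 := analyticAt_const_cpow_add hx (-(j : ℂ)) w
    simp only [← sub_eq_add_neg] at h2
    exact h1.mul h2

theorem iteratedDeriv_const_cpow_add {x : ℝ} (hx : 0 < x) (b w : ℂ) (n : ℕ) :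
    iteratedDeriv n (fun z : ℂ => (x : ℂ) ^ (z + b)) w
      = (Real.log x : ℂ) ^ n * (x : ℂ) ^ (w + b) := by
  have hx0 : (x : ℂ) ≠ 0 := by exact_mod_cast hx.ne'
  have h : (fun z : ℂ => (x : ℂ) ^ (z + b))
      = fun z => Complex.exp ((Real.log x : ℂ) * z) * (x : ℂ) ^ b := by
    ext z
    rw [Complex.cpow_add _ _ hx0, Complex.cpow_def_of_ne_zero hx0 z, Complex.ofReal_log hx.le]
  rw [h, iteratedDeriv_mul_const_field, iteratedDeriv_cexp_const_mul, Complex.cpow_add _ _ hx0,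
    Complex.cpow_def_of_ne_zero hx0 w, Complex.ofReal_log hx.le, mul_assoc]

/-- Leibniz' rule: with `a_r` the Taylor coefficients of `g` at `q`, the weight `p.choose r * r!` is
the `p!/(p-r)!` of `logSum`. -/
theorem iteratedDeriv_mul_const_cpow (p q : ℕ) (e : ℤ) {g : ℂ → ℂ} (hg : AnalyticAt ℂ g q)
    (a : ℕ → ℝ) (ha : ∀ r, iteratedDeriv r g q = (r.factorial * a r : ℝ)) {x : ℝ} (hx : 0 < x) :
    iteratedDeriv p (fun z : ℂ => g z * (x : ℂ) ^ (z + e)) q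
      = (logSum p a x * x ^ ((q : ℤ) + e) : ℝ) := by
  rw [iteratedDeriv_fun_mul hg.contDiffAt (analyticAt_const_cpow_add hx e q).contDiffAt, logSum]
  push_cast
  rw [Finset.sum_mul]
  refine Finset.sum_congr rfl fun r hr => ?_
  have hr' : r ≤ p := Nat.lt_succ_iff.1 (Finset.mem_range.1 hr)
  have h1 : (p.choose r : ℂ) * r.factorial = (p.factorial : ℂ) / (p - r).factorial := by
    rw [eq_div_iff (by exact_mod_cast (p - r).factorial_ne_zero)]
    exact_mod_cast Nat.choose_mul_factorial_mul_factorial hr'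
  have h2 : (x : ℂ) ^ ((q : ℂ) + e) = (x : ℂ) ^ ((q : ℤ) + e) := by
    rw [← Complex.cpow_intCast]
    push_cast
    rfl
  rw [iteratedDeriv_const_cpow_add hx, ha, ← h1, ← h2]
  push_cast
  ring

theorem iteratedDeriv_inv_add_one (q r : ℕ) :
    iteratedDeriv r (fun z : ℂ => (z + 1)⁻¹) q
      = (r.factorial * ((-1) ^ r / ((q : ℝ) + 1) ^ (r + 1)) : ℝ) := by
  have h := congrFun (iter_deriv_inv_linear (𝕜 := ℂ) r 1 1) q
  simp only [one_mul, one_pow, mul_one] at h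
  rw [iteratedDeriv_eq_iterate, h, show (-1 - (r : ℤ)) = -((r + 1 : ℕ) : ℤ) by push_cast; ring,
    zpow_neg, zpow_natCast]
  push_cast
  ring

theorem iteratedDeriv_polynomial_eval (P : Polynomial ℂ) (r : ℕ) :
    iteratedDeriv r (fun z : ℂ => P.eval z) = fun z => (Polynomial.derivative^[r] P).eval z := by
  induction r with
  | zero => simp
  | succ r ih =>
    rw [iteratedDeriv_succ, ih, Function.iterate_succ_apply']
    ext z
    exact Polynomial.deriv _

theorem iteratedDeriv_prod_sub (q j r : ℕ) :
    iteratedDeriv r (fun z : ℂ => ∏ i ∈ Finset.range j, (z - i)) q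
      = (r.factorial * (fallingPoly q j).coeff r : ℝ) := by
  have h : (fun z : ℂ => ∏ i ∈ Finset.range j, (z - i))
      = fun z => (fun y => ((fallingPoly q j).map Complex.ofRealHom).eval y) (z - q) := by
    ext z
    simp only [fallingPoly, Polynomial.map_prod, Polynomial.eval_prod, Polynomial.map_add,
      Polynomial.map_X, Polynomial.map_C, Polynomial.eval_add, Polynomial.eval_X,
      Polynomial.eval_C]
    refine Finset.prod_congr rfl fun i _ => ?_
    simp
  rw [h, iteratedDeriv_comp_sub_const r
    (fun y => ((fallingPoly q j).map Complex.ofRealHom).eval y) (q : ℂ),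
    iteratedDeriv_polynomial_eval]
  simp only [sub_self]
  rw [← Polynomial.coeff_zero_eq_eval_zero, Polynomial.coeff_iterate_derivative, zero_add,
    Nat.descFactorial_self, Polynomial.coeff_map]
  simp

/-- The bridge between the two families, primitive included: it turns derivatives of the
approximants to `ζ(-w)` into the real sums with logarithms. -/
theorem iteratedDeriv_cpowDeriv (p q j : ℕ) {x : ℝ} (hx : 0 < x) :
    iteratedDeriv p (fun z : ℂ => cpowDeriv z j x) q = (logPowDeriv p q j x : ℝ) := by
  cases j with
  | zero =>
    have hq : (q : ℂ) + 1 ≠ 0 := by exact_mod_cast q.succ_ne_zero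
    have h := iteratedDeriv_mul_const_cpow p q 1 (g := fun z : ℂ => (z + 1)⁻¹)
      ((analyticAt_id.add analyticAt_const).inv hq) _ (iteratedDeriv_inv_add_one q) hx
    simpa only [cpowDeriv, logPowDeriv, Int.cast_one] using h
  | succ j =>
    have h := iteratedDeriv_mul_const_cpow p q (-j)
      (g := fun z : ℂ => ∏ i ∈ Finset.range j, (z - i))
      (Finset.analyticAt_fun_prod _ fun i _ => analyticAt_id.sub analyticAt_const) _
      (iteratedDeriv_prod_sub q j) hx
    simpa only [cpowDeriv, logPowDeriv, Int.cast_neg, Int.cast_natCast, ← sub_eq_add_neg] using h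

/-! ### Convergence to the zeta function -/

/-- `∑_{k ≤ n} k^w` minus the boundary terms at `n` of its Euler–Maclaurin formula. -/
noncomputable def zetaApprox (M n : ℕ) (w : ℂ) : ℂ :=
  ∑ k ∈ Finset.Icc 1 n, (k : ℂ) ^ w - eulerMaclaurinMain (cpowDeriv w) M n

theorem analyticAt_eulerMaclaurinMain {w : ℂ} (hw : w ≠ -1) (M : ℕ) {x : ℝ} (hx : 0 < x) :
    AnalyticAt ℂ (fun z => eulerMaclaurinMain (cpowDeriv z) M x) w := by
  simp only [eulerMaclaurinMain, Complex.real_smul]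
  refine ((analyticAt_cpowDeriv hw 0 hx).add
    (analyticAt_const.mul (analyticAt_cpowDeriv hw 1 hx))).add ?_
  exact Finset.analyticAt_fun_sum _ fun k _ =>
    analyticAt_const.mul (analyticAt_cpowDeriv hw (2 * k) hx)

theorem analyticAt_sum_cpow (n : ℕ) (w : ℂ) :
    AnalyticAt ℂ (fun z : ℂ => ∑ k ∈ Finset.Icc 1 n, (k : ℂ) ^ z) w := by
  refine Finset.analyticAt_fun_sum _ fun k hk => ?_
  have hk' : (0 : ℝ) < k := by exact_mod_cast (Finset.mem_Icc.1 hk).1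
  simpa using analyticAt_const_cpow_add hk' 0 w

theorem analyticAt_zetaApprox {w : ℂ} (hw : w ≠ -1) (M : ℕ) {n : ℕ} (hn : 1 ≤ n) :
    AnalyticAt ℂ (zetaApprox M n) w :=
  (analyticAt_sum_cpow n w).sub (analyticAt_eulerMaclaurinMain hw M (by exact_mod_cast hn))

theorem iteratedDeriv_zetaApprox (p q M : ℕ) {n : ℕ} (hn : 1 ≤ n) :
    iteratedDeriv p (zetaApprox M n) q
      = (∑ k ∈ Finset.Icc 1 n, (k : ℝ) ^ q * Real.log k ^ p
        - eulerMaclaurinMain (logPowDeriv p q) M n : ℝ) := by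
  have hq : (q : ℂ) ≠ -1 := fun h => by
    have := congrArg Complex.re h
    simp at this
    linarith [q.cast_nonneg (α := ℝ)]
  have hn' : (0 : ℝ) < n := by exact_mod_cast hn
  have h1 : iteratedDeriv p (fun z : ℂ => ∑ k ∈ Finset.Icc 1 n, (k : ℂ) ^ z) q
      = (∑ k ∈ Finset.Icc 1 n, (k : ℝ) ^ q * Real.log k ^ p : ℝ) := by
    have hk (k : ℕ) (h : k ∈ Finset.Icc 1 n) : (0 : ℝ) < k := by
      exact_mod_cast (Finset.mem_Icc.1 h).1
    rw [iteratedDeriv_fun_sum fun k h =>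
      (by simpa using analyticAt_const_cpow_add (hk k h) 0 q : AnalyticAt ℂ _ _).contDiffAt,
      Complex.ofReal_sum]
    refine Finset.sum_congr rfl fun k h => ?_
    have := iteratedDeriv_const_cpow_add (hk k h) 0 q p
    simp only [add_zero, Complex.ofReal_natCast, Complex.cpow_natCast] at this
    rw [this]
    push_cast
    ring
  have hA (j : ℕ) := (analyticAt_cpowDeriv hq j hn')
  have h2 : iteratedDeriv p (fun z : ℂ => eulerMaclaurinMain (cpowDeriv z) M n) q
      = (eulerMaclaurinMain (logPowDeriv p q) M n : ℝ) := by
    simp only [eulerMaclaurinMain, Complex.real_smul]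
    rw [iteratedDeriv_fun_add, iteratedDeriv_fun_add, iteratedDeriv_const_mul_field,
      iteratedDeriv_fun_sum]
    · simp only [iteratedDeriv_const_mul_field, iteratedDeriv_cpowDeriv p q _ hn', smul_eq_mul]
      push_cast
      rfl
    · exact fun k _ => (analyticAt_const.mul (hA _)).contDiffAt
    · exact (hA 0).contDiffAt
    · exact (analyticAt_const.mul (hA _)).contDiffAt
    · exact ((hA 0).add (analyticAt_const.mul (hA _))).contDiffAt
    · exact (Finset.analyticAt_fun_sum _ fun k _ => analyticAt_const.mul (hA _)).contDiffAt
  have h := iteratedDeriv_fun_sub (n := p) (analyticAt_sum_cpow n (q : ℂ)).contDiffAt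
    (analyticAt_eulerMaclaurinMain hq M hn').contDiffAt
  rw [h1, h2] at h
  rw [Complex.ofReal_sub]
  exact h

theorem zetaApprox_succ_sub {w : ℂ} (hw : w ≠ -1) (M : ℕ) (hM : 1 ≤ M) {n : ℕ} (hn : 1 ≤ n) :
    zetaApprox M (n + 1) w - zetaApprox M n w
      = -∫ x in (n : ℝ)..(n + 1 : ℕ),
          bernoulliDiv (2 * M) (Int.fract x) • cpowDeriv w (2 * M + 1) x := by
  have h := eulerMaclaurin_step (cpowDeriv w) (fun j x hx => hasDerivAt_cpowDeriv hw j hx) M hM n hn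
  rw [cpowDeriv_one, Complex.ofReal_natCast] at h
  rw [zetaApprox, zetaApprox, Finset.sum_Icc_succ_top (by omega), h]
  abel

/-- Only the bound `σ` on `re w` enters the power of `n`, which makes the estimate uniform near a
given point. -/
theorem exists_norm_zetaApprox_succ_sub_le (M : ℕ) (hM : 1 ≤ M) :
    ∃ C : ℝ, 0 < C ∧ ∀ w : ℂ, w ≠ -1 → ∀ σ : ℝ, w.re ≤ σ → σ ≤ 2 * M → ∀ n : ℕ, 1 ≤ n →
      ‖zetaApprox M (n + 1) w - zetaApprox M n w‖
        ≤ C * ‖∏ i ∈ Finset.range (2 * M), (w - i)‖ * (n : ℝ) ^ (σ - 2 * M) := by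
  obtain ⟨C, hC, hB⟩ := exists_abs_bernoulliDiv_le (2 * M)
  refine ⟨C, hC, fun w hw σ hσ hσM n hn => ?_⟩
  have hn1 : (1 : ℝ) ≤ n := by exact_mod_cast hn
  rw [zetaApprox_succ_sub hw M hM hn, norm_neg]
  have h := intervalIntegral.norm_integral_le_of_norm_le_const (a := (n : ℝ)) (b := (n + 1 : ℕ))
    (f := fun x => bernoulliDiv (2 * M) (Int.fract x) • cpowDeriv w (2 * M + 1) x)
    (C := C * ‖∏ i ∈ Finset.range (2 * M), (w - i)‖ * (n : ℝ) ^ (σ - 2 * M)) fun x hx => by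
      rw [Set.uIoc_of_le (by push_cast; linarith)] at hx
      have hx1 : 1 ≤ x := hn1.trans hx.1.le
      rw [norm_smul, cpowDeriv, norm_mul, mul_assoc]
      refine mul_le_mul (hB _ ⟨Int.fract_nonneg x, (Int.fract_lt_one x).le⟩) ?_
        (by positivity) hC.le
      refine mul_le_mul_of_nonneg_left ?_ (norm_nonneg _)
      rw [Complex.norm_cpow_eq_rpow_re_of_pos (by linarith)]
      have hre : (w - (2 * M : ℕ)).re = w.re - 2 * M := by simp
      rw [hre]
      refine (Real.rpow_le_rpow_of_exponent_le hx1 (z := σ - 2 * M) (by linarith)).trans ?_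
      exact Real.rpow_le_rpow_of_nonpos (by linarith) hx.1.le (by linarith)
  simpa using h

/-- The domain of convergence of `zetaApprox M n` as `n → ∞`. -/
def approxDomain (M : ℕ) : Set ℂ := {w | w.re < 2 * M - 1 ∧ w ≠ -1}

theorem isOpen_approxDomain (M : ℕ) : IsOpen (approxDomain M) :=
  (isOpen_lt Complex.continuous_re continuous_const).inter isOpen_ne

/-- The Weierstrass M-test for the telescoping series: near `w` one may fix `σ < 2M - 1`, so that
the increments are `O(n^(σ-2M))` with exponent below `-1`. -/
theorem exists_tendstoLocallyUniformlyOn_zetaApprox (M : ℕ) (hM : 1 ≤ M) :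
    ∃ L : ℂ → ℂ, TendstoLocallyUniformlyOn (fun n => zetaApprox M (n + 1)) L atTop
      (approxDomain M) := by
  obtain ⟨C, hC, hbound⟩ := exists_norm_zetaApprox_succ_sub_le M hM
  let F : ℕ → ℂ → ℂ := fun n w => zetaApprox M (n + 2) w - zetaApprox M (n + 1) w
  refine ⟨fun w => zetaApprox M 1 w + ∑' n, F n w, ?_⟩
  have hpart (n : ℕ) (w : ℂ) :
      zetaApprox M (n + 1) w = zetaApprox M 1 w + ∑ k ∈ Finset.range n, F k w := by
    have := Finset.sum_range_sub (fun k => zetaApprox M (k + 1) w) n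
    simp only [zero_add] at this
    simp only [F]
    rw [this]
    ring
  refine tendstoLocallyUniformlyOn_of_forall_exists_nhds fun w hw => ?_
  obtain ⟨σ, hσ1, hσ2⟩ := exists_between hw.1
  let Q : ℂ → ℂ := fun z => ∏ i ∈ Finset.range (2 * M), (z - i)
  have hQ : Continuous Q := by fun_prop
  have hnhds : {z : ℂ | z.re < σ ∧ ‖Q z‖ < ‖Q w‖ + 1} ∩ approxDomain M ∈ nhds w := by
    refine inter_mem (IsOpen.mem_nhds ?_ ⟨hσ1, by linarith⟩) ((isOpen_approxDomain M).mem_nhds hw)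
    exact (isOpen_lt Complex.continuous_re continuous_const).inter
      (isOpen_lt hQ.norm continuous_const)
  refine ⟨_, mem_nhdsWithin_of_mem_nhds hnhds, ?_⟩
  have hsum : Summable fun n : ℕ => C * (‖Q w‖ + 1) * ((n + 1 : ℕ) : ℝ) ^ (σ - 2 * M) := by
    refine Summable.mul_left _ ?_
    exact (summable_nat_add_iff 1).2 (Real.summable_nat_rpow.2 (by linarith))
  have hunif := tendstoUniformlyOn_tsum_nat (f := F) hsum
    (s := {z : ℂ | z.re < σ ∧ ‖Q z‖ < ‖Q w‖ + 1} ∩ approxDomain M) fun n z hz => by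
      refine (hbound z hz.2.2 σ hz.1.1.le (by linarith) (n + 1) (by omega)).trans ?_
      refine mul_le_mul_of_nonneg_right ?_ (by positivity)
      exact mul_le_mul_of_nonneg_left hz.1.2.le hC.le
  rw [Metric.tendstoUniformlyOn_iff] at hunif ⊢
  intro ε hε
  filter_upwards [hunif ε hε] with n hn z hz
  rw [hpart n, dist_add_left]
  exact hn z hz

theorem tendsto_natCast_cpow_zero {v : ℂ} (hv : v.re < 0) :
    Tendsto (fun n : ℕ => ((n : ℝ) : ℂ) ^ v) atTop (nhds 0) := by
  rw [tendsto_zero_iff_norm_tendsto_zero]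
  have h := (tendsto_rpow_neg_atTop (neg_pos.2 hv)).comp tendsto_natCast_atTop_atTop (α := ℕ)
  rw [neg_neg] at h
  refine h.congr' ?_
  filter_upwards [eventually_gt_atTop 0] with n hn
  rw [Complex.norm_cpow_eq_rpow_re_of_pos (by exact_mod_cast hn), Function.comp_apply]

theorem tendsto_cpowDeriv_zero {w : ℂ} (hw : w.re < -1) (j : ℕ) :
    Tendsto (fun n : ℕ => cpowDeriv w j n) atTop (nhds 0) := by
  cases j with
  | zero =>
    have h := (tendsto_natCast_cpow_zero (v := w + 1) (by simp; linarith)).const_mul (w + 1)⁻¹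
    simpa only [cpowDeriv, mul_zero] using h
  | succ j =>
    have hj : (0 : ℝ) ≤ j := j.cast_nonneg
    have h := (tendsto_natCast_cpow_zero (v := w - j) (by simp; linarith)).const_mul
      (∏ i ∈ Finset.range j, (w - i))
    simpa only [cpowDeriv, mul_zero] using h

theorem tendsto_sum_cpow_riemannZeta {w : ℂ} (hw : w.re < -1) :
    Tendsto (fun n : ℕ => ∑ k ∈ Finset.Icc 1 n, (k : ℂ) ^ w) atTop (nhds (riemannZeta (-w))) := by
  have hre : 1 < (-w).re := by simp; linarith
  have hsum : Summable fun n : ℕ => 1 / ((n : ℂ) + 1) ^ (-w) := by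
    have := (summable_nat_add_iff 1).2 (Complex.summable_one_div_nat_cpow.2 hre)
    simpa using this
  have h := hsum.hasSum.tendsto_sum_nat
  rw [← zeta_eq_tsum_one_div_nat_add_one_cpow hre] at h
  refine h.congr fun n => ?_
  rw [← Finset.Ico_add_one_right_eq_Icc, Finset.sum_Ico_eq_sum_range, Nat.add_sub_cancel]
  refine Finset.sum_congr rfl fun k _ => ?_
  rw [Complex.cpow_neg, one_div, inv_inv]
  push_cast
  rw [add_comm]

theorem tendsto_zetaApprox_of_re_lt (M : ℕ) {w : ℂ} (hw : w.re < -1) :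
    Tendsto (fun n => zetaApprox M n w) atTop (nhds (riemannZeta (-w))) := by
  have hmain : Tendsto (fun n : ℕ => eulerMaclaurinMain (cpowDeriv w) M n) atTop (nhds 0) := by
    simp only [eulerMaclaurinMain]
    have h1 := ((tendsto_cpowDeriv_zero hw 0).add
      ((tendsto_cpowDeriv_zero hw 1).const_smul (1 / 2 : ℝ))).add
      (tendsto_finsetSum (Finset.Icc 1 M) fun k _ => (tendsto_cpowDeriv_zero hw (2 * k)).const_smul
        ((bernoulli (2 * k) : ℝ) / ((2 * k).factorial : ℝ)))
    simpa only [smul_zero, add_zero, Finset.sum_const_zero] using h1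
  have h := (tendsto_sum_cpow_riemannZeta hw).sub hmain
  rw [sub_zero] at h
  exact h

/-- A connected part of `approxDomain M` joining `re w < -1` to `-1 < re w`. -/
theorem exists_preconnected_subset_approxDomain (M : ℕ) (hM : 1 ≤ M) :
    ∃ V : Set ℂ, IsPreconnected V ∧ V ⊆ approxDomain M ∧ {w : ℂ | w.re < -1} ⊆ V ∧
      {w : ℂ | -1 < w.re ∧ w.re < 2 * M - 1} ⊆ V := by
  have hM' : (1 : ℝ) ≤ M := by exact_mod_cast hM
  have hA : Convex ℝ {w : ℂ | w.re < -1} := convex_halfSpace_re_lt _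
  have hB : Convex ℝ ({w : ℂ | 0 < w.im} ∩ {w : ℂ | w.re < 2 * M - 1}) :=
    (convex_halfSpace_im_gt _).inter (convex_halfSpace_re_lt _)
  have hC : Convex ℝ ({w : ℂ | -1 < w.re} ∩ {w : ℂ | w.re < 2 * M - 1}) :=
    (convex_halfSpace_re_gt _).inter (convex_halfSpace_re_lt _)
  -- Three convex pieces: the middle one passes above the excluded point `-1` and meets the outer
  -- ones at `-2 + i` and `i`.
  refine ⟨({w : ℂ | w.re < -1} ∪ ({w : ℂ | 0 < w.im} ∩ {w : ℂ | w.re < 2 * M - 1}))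
    ∪ ({w : ℂ | -1 < w.re} ∩ {w : ℂ | w.re < 2 * M - 1}), ?_, ?_, ?_, ?_⟩
  · refine IsPreconnected.union ⟨0, 1⟩ (Or.inr ?_) ?_ (IsPreconnected.union ⟨-2, 1⟩ ?_ ?_
      hA.isPreconnected hB.isPreconnected) hC.isPreconnected
    · exact ⟨by simp, by simp; linarith⟩
    · exact ⟨by simp, by simp; linarith⟩
    · simp
    · exact ⟨by simp, by simp; linarith⟩
  · rintro w ((hw | hw) | hw)
    · refine ⟨?_, ?_⟩
      · have : w.re < -1 := hw
        linarith
      · rintro rfl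
        simp at hw
    · refine ⟨hw.2, ?_⟩
      rintro rfl
      simp at hw
    · refine ⟨hw.2, ?_⟩
      rintro rfl
      simp at hw
  · exact fun w hw => Or.inl (Or.inl hw)
  · exact fun w hw => Or.inr hw

theorem tendstoLocallyUniformlyOn_iteratedDeriv {F : ℕ → ℂ → ℂ} {f : ℂ → ℂ} {U : Set ℂ}
    (hU : IsOpen U) (hF : ∀ n, DifferentiableOn ℂ (F n) U)
    (h : TendstoLocallyUniformlyOn F f atTop U) (p : ℕ) :
    TendstoLocallyUniformlyOn (fun n => iteratedDeriv p (F n)) (iteratedDeriv p f) atTop U := by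
  have hF' : ∀ p n, DifferentiableOn ℂ (iteratedDeriv p (F n)) U := by
    intro p n
    induction p with
    | zero => simpa using hF n
    | succ p ih =>
      rw [iteratedDeriv_succ]
      exact ih.deriv hU
  induction p with
  | zero => simpa using h
  | succ p ih =>
    simp only [iteratedDeriv_succ]
    exact ih.deriv (Eventually.of_forall (hF' p)) hU

/-- The limit equals `ζ(-w)` for `re w < -1`, hence near `q` by the identity theorem; `hM` puts `q`
inside `re w < 2M - 1`. The sign comes from the inner `-w`. -/
theorem tendsto_iteratedDeriv_zetaApprox (p q M : ℕ) (hM : q + 2 ≤ 2 * M) :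
    Tendsto (fun n => iteratedDeriv p (zetaApprox M (n + 1)) q) atTop
      (nhds ((-1) ^ p * iteratedDeriv p riemannZeta (-(q : ℂ)))) := by
  have hM1 : 1 ≤ M := by omega
  have hMq : (q : ℝ) + 2 ≤ 2 * M := by exact_mod_cast hM
  have hq0 : (0 : ℝ) ≤ q := q.cast_nonneg
  obtain ⟨L, hL⟩ := exists_tendstoLocallyUniformlyOn_zetaApprox M hM1
  have hU := isOpen_approxDomain M
  have hF (n : ℕ) : DifferentiableOn ℂ (zetaApprox M (n + 1)) (approxDomain M) := fun w hw =>
    (analyticAt_zetaApprox hw.2 M (by omega)).differentiableAt.differentiableWithinAt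
  have hqU : (q : ℂ) ∈ {w : ℂ | -1 < w.re ∧ w.re < 2 * M - 1} :=
    ⟨by simp; linarith, by simp; linarith⟩
  obtain ⟨V, hV, hVU, hVl, hVr⟩ := exists_preconnected_subset_approxDomain M hM1
  have hLd : AnalyticOnNhd ℂ L V :=
    ((hL.differentiableOn (Eventually.of_forall hF) hU).analyticOnNhd hU).mono hVU
  have hζ : AnalyticOnNhd ℂ (fun w => riemannZeta (-w)) V := by
    refine AnalyticOnNhd.mono (DifferentiableOn.analyticOnNhd (fun w hw => ?_) hU) hVU
    have hw' : -w ≠ 1 := fun h => hw.2 (by rw [← h, neg_neg])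
    exact ((differentiableAt_riemannZeta hw').comp w differentiableAt_id.neg).differentiableWithinAt
  have heqA : ∀ w : ℂ, w.re < -1 → L w = riemannZeta (-w) := fun w hw =>
    tendsto_nhds_unique (hL.tendsto_at (hVU (hVl hw)))
      ((tendsto_add_atTop_iff_nat 1).2 (tendsto_zetaApprox_of_re_lt M hw))
  have hm2 : (-2 : ℂ) ∈ {w : ℂ | w.re < -1} := by simp
  have heqV : Set.EqOn L (fun w => riemannZeta (-w)) V := by
    refine hLd.eqOn_of_preconnected_of_eventuallyEq hζ hV (hVl hm2) ?_
    filter_upwards [(isOpen_lt Complex.continuous_re continuous_const).mem_nhds hm2] with w hw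
    exact heqA w hw
  have hev : L =ᶠ[nhds (q : ℂ)] fun w => riemannZeta (-w) := by
    have hopen : IsOpen {w : ℂ | -1 < w.re ∧ w.re < 2 * M - 1} :=
      (isOpen_lt continuous_const Complex.continuous_re).inter
        (isOpen_lt Complex.continuous_re continuous_const)
    filter_upwards [hopen.mem_nhds hqU] with w hw
    exact heqV (hVr hw)
  have h := (tendstoLocallyUniformlyOn_iteratedDeriv hU hF hL p).tendsto_at (hVU (hVr hqU))
  rwa [hev.iteratedDeriv_eq, iteratedDeriv_comp_neg, smul_eq_mul] at h

theorem tendsto_integral_remainderIntegrand (p q M : ℕ) (hM : (q + 1) / 2 + 1 ≤ M) :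
    Tendsto (fun n : ℕ => ∫ x in Set.Ioi (n : ℝ), remainderIntegrand p q M x) atTop (nhds 0) := by
  have hint := integrableOn_remainderIntegrand p q M hM
  have h := (intervalIntegral_tendsto_integral_Ioi 1 hint tendsto_natCast_atTop_atTop (ι := ℕ)
    (l := atTop)).const_sub (∫ x in Set.Ioi (1 : ℝ), remainderIntegrand p q M x)
  rw [sub_self] at h
  refine h.congr' ?_
  filter_upwards [eventually_ge_atTop 1] with n hn
  rw [← intervalIntegral.integral_Ioi_sub_Ioi hint (by exact_mod_cast hn), sub_sub_cancel]

/-- Two computations of the limit of the `p`-th derivative of `zetaApprox` at `q` are compared. As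
the right-hand side is free of `M`, so is the constant. -/
theorem constantOfOrder_eq (p q M : ℕ) (hp : 1 ≤ p) (hM : (q + 1) / 2 + 1 ≤ M) :
    (constantOfOrder p q M : ℂ) = (-1) ^ p * iteratedDeriv p riemannZeta (-(q : ℂ))
      + (((bernoulli (q + 1) : ℝ) / ((q : ℝ) + 1) * (p.factorial : ℝ) * S p 1 q : ℝ) : ℂ) := by
  set K : ℝ := (bernoulli (q + 1) : ℝ) / ((q : ℝ) + 1) * (p.factorial : ℝ) * S p 1 q with hK
  have h1 := tendsto_iteratedDeriv_zetaApprox p q M (by omega)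
  have h2 : Tendsto (fun n => iteratedDeriv p (zetaApprox M (n + 1)) q) atTop
      (nhds ((constantOfOrder p q M - K : ℝ) : ℂ)) := by
    have h3 : Tendsto (fun n : ℕ => constantOfOrder p q M - K
        + ∫ x in Set.Ioi ((n + 1 : ℕ) : ℝ), remainderIntegrand p q M x) atTop
        (nhds (constantOfOrder p q M - K)) := by
      have := ((tendsto_add_atTop_iff_nat 1).2
        (tendsto_integral_remainderIntegrand p q M hM)).const_add (constantOfOrder p q M - K)
      rwa [add_zero] at this
    refine ((Complex.continuous_ofReal.tendsto _).comp h3).congr fun n => ?_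
    rw [iteratedDeriv_zetaApprox p q M (by omega), Function.comp_apply,
      sum_pow_mul_log_pow_eq p q M (n + 1) hp hM (by omega),
      eulerMaclaurinMain_logPowDeriv p q M (n + 1) hp (by omega), ← hK]
    congr 1
    ring
  have h := tendsto_nhds_unique h1 h2
  rw [h]
  push_cast
  ring

/-! ### The error term -/

theorem pow_div_zpow_isBigO {i l : ℕ} (hil : i ≤ l) {a b : ℤ} (hab : b ≤ a) :
    (fun n : ℕ => Real.log n ^ i / (n : ℝ) ^ a) =O[atTop]
      fun n : ℕ => Real.log n ^ l / (n : ℝ) ^ b := by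
  refine IsBigO.of_bound 1 ?_
  have hlog : ∀ᶠ n : ℕ in atTop, 1 ≤ Real.log n :=
    (Real.tendsto_log_atTop.comp tendsto_natCast_atTop_atTop).eventually_ge_atTop 1
  filter_upwards [hlog, eventually_ge_atTop 1] with n hn hn1
  have hn1' : (1 : ℝ) ≤ n := by exact_mod_cast hn1
  have hn0 : (0 : ℝ) < n := by linarith
  have hl0 : 0 ≤ Real.log n := by linarith
  rw [one_mul, Real.norm_of_nonneg (by positivity), Real.norm_of_nonneg (by positivity)]
  exact div_le_div₀ (by positivity) (pow_le_pow_right₀ hn hil) (by positivity)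
    (zpow_le_zpow_right₀ hn1' hab)

theorem expansion_sub_expansion (p q m n : ℕ) :
    expansion p q (max m ((q + 1) / 2) + 1) n - expansion p q m n
      = (∑ r ∈ Finset.Icc 1 p, d p q (max m ((q + 1) / 2) + 1) r * Real.log n ^ (p - r))
        / (n : ℝ) ^ (2 * (max m ((q + 1) / 2) + 1) - q - 1) := by
  -- For `m < ⌈q/2⌉` both ranges are empty.
  have h : Finset.Icc ((q + 1) / 2 + 1) m
      = Finset.Icc ((q + 1) / 2 + 1) (max m ((q + 1) / 2)) := by
    ext k
    simp only [Finset.mem_Icc]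
    omega
  simp only [expansion]
  rw [h, Finset.sum_Icc_succ_top (by omega)]
  ring

/-- Euler–Maclaurin is applied at an order `M ≥ m + 1` for which the remainder converges. The one
extra block of `d` terms has `r ≥ 1`, so at most `(log n)^(p-1)`, and the remainder is
`O(n^(q-2M+2))`, hence `O(n^(q-2m))` without logarithms. -/
theorem isBigO_sum_sub_expansion (p q m : ℕ) (hp : 1 ≤ p) :
    (fun n : ℕ => (∑ k ∈ Finset.Icc 1 n, (k : ℝ) ^ q * Real.log k ^ p)
        - (expansion p q m n + constantOfOrder p q (max m ((q + 1) / 2) + 1)))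
      =O[atTop] fun n : ℕ => Real.log n ^ (p - 1) / (n : ℝ) ^ (2 * (m : ℤ) - (q : ℤ)) := by
  set M := max m ((q + 1) / 2) + 1 with hM
  have hMq : (q + 1) / 2 + 1 ≤ M := by omega
  have hMm : m + 1 ≤ M := by omega
  have h1 : (fun n : ℕ => (∑ r ∈ Finset.Icc 1 p, d p q M r * Real.log n ^ (p - r))
      / (n : ℝ) ^ (2 * M - q - 1))
      =O[atTop] fun n : ℕ => Real.log n ^ (p - 1) / (n : ℝ) ^ (2 * (m : ℤ) - (q : ℤ)) := by
    have : (fun n : ℕ => (∑ r ∈ Finset.Icc 1 p, d p q M r * Real.log n ^ (p - r))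
        / (n : ℝ) ^ (2 * M - q - 1)) = fun n : ℕ => ∑ r ∈ Finset.Icc 1 p,
          d p q M r * (Real.log n ^ (p - r) / (n : ℝ) ^ ((2 * M - q - 1 : ℕ) : ℤ)) := by
      ext n
      rw [Finset.sum_div]
      exact Finset.sum_congr rfl fun r _ => by rw [zpow_natCast, mul_div_assoc]
    rw [this]
    refine IsBigO.fun_sum fun r hr => (pow_div_zpow_isBigO ?_ ?_).const_mul_left _
    · have := (Finset.mem_Icc.1 hr).1
      omega
    · omega
  have h2 : (fun n : ℕ => ∫ x in Set.Ioi (n : ℝ), remainderIntegrand p q M x)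
      =O[atTop] fun n : ℕ => Real.log n ^ (p - 1) / (n : ℝ) ^ (2 * (m : ℤ) - (q : ℤ)) := by
    obtain ⟨C, hC⟩ := exists_integral_remainderIntegrand_le p q M hMq
    refine IsBigO.trans (IsBigO.of_bound C ?_)
      (pow_div_zpow_isBigO (i := 0) (Nat.zero_le _) (a := 2 * M - q - 2) (by omega))
    filter_upwards [eventually_ge_atTop 1] with n hn
    rw [Real.norm_eq_abs, pow_zero, one_div, ← zpow_neg,
      Real.norm_of_nonneg (zpow_nonneg n.cast_nonneg _)]
    refine (hC n hn).trans (le_of_eq ?_)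
    congr 2
    ring
  refine (h1.add h2).congr' ?_ EventuallyEq.rfl
  filter_upwards [eventually_ge_atTop 1] with n hn
  rw [sum_pow_mul_log_pow_eq p q M n hp hMq hn, hM, ← expansion_sub_expansion p q m n]
  ring

end LogPowerSum

theorem mainTheorem2 (p q : ℕ) (hp : 1 ≤ p) :
    ∃ const : ℝ,
      -- the closed form of the constant
      (const : ℂ) = (-1) ^ p * iteratedDeriv p riemannZeta (-(q : ℂ))
          + (((bernoulli (q + 1) : ℝ) / ((q : ℝ) + 1) * (p.factorial : ℝ)
              * LogPowerSum.S p 1 q : ℝ) : ℂ) ∧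
      -- the asymptotic expansion to arbitrary order
      (∀ m : ℕ,
        (fun n : ℕ => (∑ k ∈ Finset.Icc 1 n, (k : ℝ) ^ q * Real.log k ^ p)
            - (LogPowerSum.expansion p q m n + const))
          =O[atTop] fun n : ℕ => Real.log n ^ (p - 1) / (n : ℝ) ^ (2 * (m : ℤ) - (q : ℤ))) ∧
      -- the Bernoulli sum for the constant, cut off at any order, with its remainder
      (∀ M : ℕ, (q + 1) / 2 + 1 ≤ M →
        IntegrableOn (LogPowerSum.remainderIntegrand p q M) (Set.Ioi 1) ∧
        const = (-1) ^ (p + 1) * (p.factorial : ℝ) / ((q : ℝ) + 1) ^ (p + 1)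
          - ∑ k ∈ Finset.Icc 1 (q / 2), LogPowerSum.c p q k p
          - ∑ k ∈ Finset.Icc ((q + 1) / 2 + 1) M, LogPowerSum.d p q k p
          - ∫ x in Set.Ioi (1 : ℝ), LogPowerSum.remainderIntegrand p q M x) := by
  -- The witness is the constant of the lowest admissible order; the zeta formula identifies it with
  -- those of all higher orders.
  have hconst : ∀ M : ℕ, (q + 1) / 2 + 1 ≤ M →
      LogPowerSum.constantOfOrder p q ((q + 1) / 2 + 1) = LogPowerSum.constantOfOrder p q M := by
    intro M hM
    have h := LogPowerSum.constantOfOrder_eq p q M hp hM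
    rw [← LogPowerSum.constantOfOrder_eq p q _ hp le_rfl] at h
    exact_mod_cast h.symm
  refine ⟨LogPowerSum.constantOfOrder p q ((q + 1) / 2 + 1),
    LogPowerSum.constantOfOrder_eq p q _ hp le_rfl, fun m => ?_, fun M hM => ⟨?_, ?_⟩⟩
  · rw [hconst (max m ((q + 1) / 2) + 1) (by omega)]
    exact LogPowerSum.isBigO_sum_sub_expansion p q m hp
  · exact LogPowerSum.integrableOn_remainderIntegrand p q M hM
  · rw [hconst M hM, LogPowerSum.constantOfOrder, LogPowerSum.expansion_one p q M hp, neg_neg]
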